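/- Let $\gamma\subset\mathbb C$ be a simple, piecewise $C^1$-regular loop that starts at the origin, encircles the point at infinity once, and returns to the origin; fix a continuous branch of $\log$ on $\gamma\setminus\{0\}$. Let $W$ be a regular $N\times N$ matrix of weights of Bessel type on $\gamma$, that is: - each entry of $W$ is, on $\gamma\setminus\{0\}$, a finite sum of terms $\varphi(z)\,z^{p}\log^{q}(z)\,e^{-\lambda/z}$ with $\varphi$ entire and without zeros on $\gamma$, $p\in\mathbb C$, $q\in\mathbb N=\{0,1,2,\dots\}$, $\operatorname{Re}\lambda\ge 0$; - $W$ is integrable along $\gamma$, and its moments $W_n=\int_\gamma z^nW(z)\frac{dz}{2\pi i}$ satisfy $\det[W_{j+k}]_{j,k=0,\dots,n}\neq0$ for all $n\in\mathbb N$. Suppose that $W=W^{L}W^{R}$ on $\gamma$, where $W^L,W^R$ are nonsingular holomorphic matrix functions of $z\neq 0$, possibly multivalued with a branch point at $0$ (i.e. holomorphic on the Riemann surface of the logarithm), satisfying $$z^2 (W^L)'=h^L W^L,\qquad z^2 (W^R)'=W^R h^R,\qquad h^L(z)=A^Lz+B^L,\quad h^R(z)=A^Rz+B^R,$$ with constant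 $N\times N$ complex matrices $A^L,B^L,A^R,B^R$. Let $P_n^L,P_n^R$ be the monic matrix polynomials of degree $n$, and $C_n$ the nonsingular matrices, with $$\int_\gamma P_n^L(z)W(z)z^k\frac{dz}{2\pi i}=\delta_{n,k}C_n^{-1}=\int_\gamma z^kW(z)P_n^R(z)\frac{dz}{2\pi i},\qquad 0\le k\le n .$$ Let $p^1_{L,n},p^1_{R,n}$ be the coefficients of $z^{n-1}$ in $P^L_n,P^R_n$ ($p^1_{L,0}=p^1_{R,0}=0$). For $z\notin\gamma$ put $$Q_n^L(z)=\int_\gamma\frac{P_n^L(t)W(t)}{t-z}\frac{dt}{2\pi i},\qquad Q_n^R(z)=\int_\gamma\frac{W(t)P_n^R(t)}{t-z}\frac{dt}{2\pi i},$$ $$Y_n^L=\begin{bmatrix}P_n^L&Q_n^L\\-C_{n-1}P_{n-1}^L&-C_{n-1}Q_{n-1}^L\end{bmatrix},\qquad Y_n^R=\begin{bmatrix}P_n^R&-P_{n-1}^RC_{n-1}\\Q_n^R&-Q_{n-1}^RC_{n-1}\end{bmatrix},$$ where for $n=0$ the blocks with index $-1$ are given by $-C_{-1}P^L_{-1}=-P^R_{-1}C_{-1}=0$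 and $-C_{-1}Q^L_{-1}=-Q^R_{-1}C_{-1}=I$. Let $$Z_n^L=Y_n^L\begin{bmatrix}W^L&0\\0&(W^R)^{-1}\end{bmatrix},\quad Z_n^R=\begin{bmatrix}W^R&0\\0&(W^L)^{-1}\end{bmatrix}Y_n^R,\quad M_n^L=(Z_n^L)'(Z_n^L)^{-1},\quad M_n^R=(Z_n^R)^{-1}(Z_n^R)' .$$ Then, for every $n\in\mathbb N$ and $z\in\mathbb C\setminus\gamma$ and for every branch of $W^L,W^R$ near $z$ (the same branch of the logarithm in both), the matrices $Z_n^L,Z_n^R$ are holomorphic near $z$ and invertible at $z$, and, with $[X,Y]=XY-YX$ and $C_{-1}:=0$ in the formulas below, $$z^2M_n^L(z)=\begin{bmatrix}(A^L+nI)z+[p^1_{L,n},A^L]-p^1_{L,n}+B^L & A^LC_n^{-1}+C_n^{-1}A^R+(2n+1)C_n^{-1}\\ -C_{n-1}A^L-A^RC_{n-1}-(2n-1)C_{n-1} & -(nI+A^R)z+[p^1_{R,n},A^R]+p^1_{R,n}-B^R\end{bmatrix},$$ $$z^2M_n^R(z)=\begin{bmatrix}(nI+A^R)z-[p^1_{R,n},A^R]-p^1_{R,n}+B^R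 & -C_{n-1}A^L-A^RC_{n-1}-(2n-1)C_{n-1}\\ A^LC_n^{-1}+C_n^{-1}A^R+(2n+1)C_n^{-1} & -(A^L+nI)z-[p^1_{L,n},A^L]+p^1_{L,n}-B^L\end{bmatrix}.$$ -/

import Mathlib

open scoped Matrix Topology

noncomputable section

namespace BesselMOP

/-- Complex `N × N` matrices. -/
abbrev Mat (N : ℕ) : Type := Matrix (Fin N) (Fin N) ℂ

/-- Complex `2N × 2N` matrices, written in `N × N` blocks. -/
abbrev BlockMat (N : ℕ) : Type := Matrix (Fin N ⊕ Fin N) (Fin N ⊕ Fin N) ℂ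

/-- The entrywise derivative of a matrix valued function of one complex variable. -/
def matDeriv {ι : Type} (F : ℂ → Matrix ι ι ℂ) (z : ℂ) : Matrix ι ι ℂ :=
  Matrix.of fun i j => deriv (fun x => F x i j) z

/-! ### The contour -/

/-- A parametrised simple loop `γ : [0,1] → ℂ` which starts at the origin, returns to the origin,
and is piecewise `C¹` with nonvanishing one-sided derivatives (corners are allowed, in particular
at the origin). -/
structure IsLoop (γ : ℝ → ℂ) : Prop where
  continuousOn : ContinuousOn γ (Set.Icc 0 1)
  start : γ 0 = 0
  finish : γ 1 = 0
  injOn : Set.InjOn γ (Set.Ico 0 1)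
  piecewise_regular : ∃ (k : ℕ) (t : ℕ → ℝ), t 0 = 0 ∧ t k = 1 ∧
    ∀ i < k, t i < t (i + 1) ∧ ContDiffOn ℝ 1 γ (Set.Icc (t i) (t (i + 1))) ∧
      ∀ s ∈ Set.Icc (t i) (t (i + 1)), derivWithin γ (Set.Icc (t i) (t (i + 1))) s ≠ 0

/-- The point set of the loop (it contains the origin). -/
def loopTrace (γ : ℝ → ℂ) : Set ℂ := γ '' Set.Icc 0 1

/-- `lg` is a continuous branch of the logarithm along the loop with the origin removed. -/
structure IsLogAlong (γ lg : ℝ → ℂ) : Prop where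
  continuousOn : ContinuousOn lg (Set.Ioo 0 1)
  exp_eq : ∀ s ∈ Set.Ioo (0 : ℝ) 1, Complex.exp (lg s) = γ s

/-- `lg` is a holomorphic branch of the logarithm near the point `z`. -/
def IsLogBranchAt (lg : ℂ → ℂ) (z : ℂ) : Prop :=
  AnalyticAt ℂ lg z ∧ ∀ᶠ x in 𝓝 z, Complex.exp (lg x) = x

/-- `∫_γ F(z) dz / (2πi)` for a matrix valued integrand, entry by entry. -/
def loopIntegral {N : ℕ} (γ : ℝ → ℂ) (F : ℂ → Mat N) : Mat N :=
  Matrix.of fun j k =>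
    (2 * (Real.pi : ℂ) * Complex.I)⁻¹ * ∫ s in (0 : ℝ)..1, deriv γ s * F (γ s) j k

/-! ### Regular matrices of weights of Bessel type -/

/-- The moments `W_n = ∫_γ zⁿ W(z) dz / (2πi)`. -/
def moment {N : ℕ} (γ : ℝ → ℂ) (W : ℂ → Mat N) (n : ℕ) : Mat N :=
  loopIntegral γ fun z => z ^ n • W z

/-- The block Hankel matrix `[W_{j+k}]_{j,k=0,…,n}`. -/
def hankel {N : ℕ} (γ : ℝ → ℂ) (W : ℂ → Mat N) (n : ℕ) :
    Matrix (Fin (n + 1) × Fin N) (Fin (n + 1) × Fin N) ℂ :=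
  Matrix.of fun a b => moment γ W ((a.1 : ℕ) + (b.1 : ℕ)) a.2 b.2

/-- `W` is a regular matrix of weights of Bessel type with support on the loop `γ`, where `lg` is
the branch of `log` on `γ`. Each entry is a finite sum of terms
`φ(z) z^p (log z)^q exp(-λ/z)` with `φ` entire (hence bounded and Hölder continuous on the compact
set `γ`) without zeros on `γ`, `q ∈ ℕ` and `Re λ ≥ 0`; the entries are integrable along `γ`, so
that all the moments exist; and all block Hankel determinants are nonzero.
Only the values of `W` on `γ` with the origin removed play a role. -/
structure IsRegularBesselWeight {N : ℕ} (γ lg : ℝ → ℂ) (W : ℂ → Mat N) : Prop where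
  entries : ∀ j k : Fin N, ∃ (m : ℕ) (φ : Fin m → ℂ → ℂ) (p : Fin m → ℂ) (q : Fin m → ℕ)
    (lam : Fin m → ℂ),
    (∀ i, Differentiable ℂ (φ i)) ∧ (∀ i, ∀ z ∈ loopTrace γ, φ i z ≠ 0) ∧
    (∀ i, 0 ≤ (lam i).re) ∧
    ∀ s ∈ Set.Ioo (0 : ℝ) 1, W (γ s) j k =
      ∑ i, φ i (γ s) * Complex.exp (p i * lg s) * lg s ^ q i * Complex.exp (-(lam i) / γ s)
  integrable : ∀ j k : Fin N,
    IntervalIntegrable (fun s => deriv γ s * W (γ s) j k) MeasureTheory.volume 0 1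
  regular : ∀ n : ℕ, (hankel γ W n).det ≠ 0

/-! ### The factorisation and the Pearson equations

The factors `W_L`, `W_R` are in general multivalued in `z`, with a branch point at `0`. They are
holomorphic functions on the Riemann surface of the logarithm, that is, holomorphic functions of
`w = log z ∈ ℂ`; the value over `z` on a given branch is `W_L (log z)`, and since `d/dw = z d/dz`,
the operator `z² d/dz` reads `exp w • d/dw`. -/

/-- `z² W_L'(z) = h(z) W_L(z)`, with `W_L` holomorphic and nonsingular on the Riemann surface of
the logarithm. -/
structure SolvesLeft {N : ℕ} (h : ℂ → Mat N) (WL : ℂ → Mat N) : Prop where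
  holomorphic : ∀ i j, Differentiable ℂ fun w => WL w i j
  nonsingular : ∀ w, IsUnit (WL w).det
  equation : ∀ w, Complex.exp w • matDeriv WL w = h (Complex.exp w) * WL w

/-- `z² W_R'(z) = W_R(z) h(z)`, with `W_R` holomorphic and nonsingular on the Riemann surface of
the logarithm. -/
structure SolvesRight {N : ℕ} (h : ℂ → Mat N) (WR : ℂ → Mat N) : Prop where
  holomorphic : ∀ i j, Differentiable ℂ fun w => WR w i j
  nonsingular : ∀ w, IsUnit (WR w).det
  equation : ∀ w, Complex.exp w • matDeriv WR w = WR w * h (Complex.exp w)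

/-- `W(z) = W_L(z) W_R(z)` on `γ`, for the branch `lg` of the logarithm on `γ`. -/
def Factorises {N : ℕ} (γ lg : ℝ → ℂ) (W WL WR : ℂ → Mat N) : Prop :=
  ∀ s ∈ Set.Ioo (0 : ℝ) 1, W (γ s) = WL (lg s) * WR (lg s)

/-! ### Biorthogonal polynomials and functions of the second kind -/

/-- The value at `z ∈ ℂ` of a polynomial with matrix coefficients. -/
def evalAt {N : ℕ} (P : Polynomial (Mat N)) (z : ℂ) : Mat N :=
  P.eval (Matrix.scalar (Fin N) z)

/-- `P_n^L` and `P_n^R` are the monic left and right orthogonal polynomials of degree `n` for the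
weight `W`, with (nonsingular) normalisation matrices `C_n`. -/
structure IsBiorthogonalSystem {N : ℕ} (γ : ℝ → ℂ) (W : ℂ → Mat N)
    (PL PR : ℕ → Polynomial (Mat N)) (C : ℕ → Mat N) : Prop where
  monicL : ∀ n, (PL n).Monic
  monicR : ∀ n, (PR n).Monic
  degreeL : ∀ n, (PL n).natDegree = n
  degreeR : ∀ n, (PR n).natDegree = n
  nonsingular : ∀ n, IsUnit (C n).det
  orthogonalL : ∀ n, ∀ k ≤ n,
    loopIntegral γ (fun z => z ^ k • (evalAt (PL n) z * W z)) = if n = k then (C n)⁻¹ else 0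
  orthogonalR : ∀ n, ∀ k ≤ n,
    loopIntegral γ (fun z => z ^ k • (W z * evalAt (PR n) z)) = if n = k then (C n)⁻¹ else 0

/-- `Q^L(z) = ∫_γ P^L(z') W(z') / (z' - z) dz' / (2πi)`. -/
def secondKindL {N : ℕ} (γ : ℝ → ℂ) (W : ℂ → Mat N) (P : Polynomial (Mat N)) (z : ℂ) : Mat N :=
  loopIntegral γ fun x => (x - z)⁻¹ • (evalAt P x * W x)

/-- `Q^R(z) = ∫_γ W(z') P^R(z') / (z' - z) dz' / (2πi)`. -/
def secondKindR {N : ℕ} (γ : ℝ → ℂ) (W : ℂ → Mat N) (P : Polynomial (Mat N)) (z : ℂ) : Mat N :=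
  loopIntegral γ fun x => (x - z)⁻¹ • (W x * evalAt P x)

/-- The matrix `Y_n^L`. For `n = 0` the initial conditions `P_{-1} = 0` and `C_{-1} Q_{-1} = -I`
are used. -/
def YL {N : ℕ} (γ : ℝ → ℂ) (W : ℂ → Mat N) (PL : ℕ → Polynomial (Mat N)) (C : ℕ → Mat N) :
    ℕ → ℂ → BlockMat N
  | 0, z => Matrix.fromBlocks (evalAt (PL 0) z) (secondKindL γ W (PL 0) z) 0 1
  | n + 1, z => Matrix.fromBlocks
      (evalAt (PL (n + 1)) z) (secondKindL γ W (PL (n + 1)) z)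
      (-(C n * evalAt (PL n) z)) (-(C n * secondKindL γ W (PL n) z))

/-- The matrix `Y_n^R`. For `n = 0` the initial conditions `P_{-1} = 0` and `Q_{-1} C_{-1} = -I`
are used. -/
def YR {N : ℕ} (γ : ℝ → ℂ) (W : ℂ → Mat N) (PR : ℕ → Polynomial (Mat N)) (C : ℕ → Mat N) :
    ℕ → ℂ → BlockMat N
  | 0, z => Matrix.fromBlocks (evalAt (PR 0) z) 0 (secondKindR γ W (PR 0) z) 1
  | n + 1, z => Matrix.fromBlocks
      (evalAt (PR (n + 1)) z) (-(evalAt (PR n) z * C n))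
      (secondKindR γ W (PR (n + 1)) z) (-(secondKindR γ W (PR n) z * C n))

/-! ### Fundamental matrices and structure matrices -/

/-- `Z_n^L = Y_n^L diag(W_L, W_R⁻¹)`, on the branch `lg` of the logarithm. -/
def ZL {N : ℕ} (γ : ℝ → ℂ) (W WL WR : ℂ → Mat N) (PL : ℕ → Polynomial (Mat N)) (C : ℕ → Mat N)
    (lg : ℂ → ℂ) (n : ℕ) (z : ℂ) : BlockMat N :=
  YL γ W PL C n z * Matrix.fromBlocks (WL (lg z)) 0 0 (WR (lg z))⁻¹

/-- `Z_n^R = diag(W_R, W_L⁻¹) Y_n^R`, on the branch `lg` of the logarithm. -/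
def ZR {N : ℕ} (γ : ℝ → ℂ) (W WL WR : ℂ → Mat N) (PR : ℕ → Polynomial (Mat N)) (C : ℕ → Mat N)
    (lg : ℂ → ℂ) (n : ℕ) (z : ℂ) : BlockMat N :=
  Matrix.fromBlocks (WR (lg z)) 0 0 (WL (lg z))⁻¹ * YR γ W PR C n z

/-- The left logarithmic derivative `Z' Z⁻¹`; the structure matrix `M_n^L` is that of `Z_n^L`. -/
def leftLogDeriv {N : ℕ} (Z : ℂ → BlockMat N) (z : ℂ) : BlockMat N :=
  matDeriv Z z * (Z z)⁻¹

/-- The right logarithmic derivative `Z⁻¹ Z'`; the structure matrix `M_n^R` is that of `Z_n^R`. -/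
def rightLogDeriv {N : ℕ} (Z : ℂ → BlockMat N) (z : ℂ) : BlockMat N :=
  (Z z)⁻¹ * matDeriv Z z

/-- `Z` is holomorphic near `z` and `Z(z)` is invertible. -/
def IsRegularAt {N : ℕ} (Z : ℂ → BlockMat N) (z : ℂ) : Prop :=
  (∀ i j, AnalyticAt ℂ (fun x => Z x i j) z) ∧ IsUnit (Z z).det

/-- `C_{n-1}`, with the convention `C_{-1} = 0`. -/
def prevC {N : ℕ} (C : ℕ → Mat N) : ℕ → Mat N
  | 0 => 0
  | n + 1 => C n

/-- The commutator `[X, Y] = X Y - Y X`. -/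
def matComm {N : ℕ} (X Y : Mat N) : Mat N := X * Y - Y * X

end BesselMOP

end

open BesselMOP

noncomputable section

namespace BesselMOP

open Set Filter MeasureTheory

/-! ### The loop -/

/-! The proof is algebraic: it rests on integration by parts along the loop, biorthogonality, and
the inverse relation between the left and right problems.

The Pearson equations give `z² W' = h^L W + W h^R` on the loop. The function `γ² W` has an
integrable derivative along the loop, so it has limits at both ends. A nonzero limit would give `γ'
W` exact order `s⁻²`, against integrability of the weight. Hence boundary terms vanish
(`continuousOn_sq_mul`), and `integral_pearson` and `pairing_pearsonOp` give the adjoint rule for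
the operator `T P = z² P' + P h^L`.

Testing that rule against powers determines the moments of `T P_n`. A polynomial of degree below `n`
with `n` vanishing moments is zero (`eq_zero_of_polyMoment`), so comparing top coefficients and low
moments yields two expansions of `T P_n`: `pearsonOp_succ` uses `P_{n-1}`, while `pearsonOp_eq` uses
`P_{n+1}`. Testing against `1/(t - z)` transports both to the functions of the second kind. Together
they give `z² Y' + Y diag(h^L, -h^R) = M Y` in `YL_relation`, with `M` the claimed left matrix.
Multiplication by the factors of the weight turns this into the equation for `Z^L`.

Christoffel–Darboux identities show that `J Y^R J⁻¹` is inverse to `Y^L`, where `J` is `sympl N`;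
the same holds for the `Z` matrices (`ZL_mul_conj_ZR`). This gives invertibility and, by
differentiation, `M^R = -J⁻¹ M^L J`. -/

theorem isCompact_loopTrace {γ : ℝ → ℂ} (hγ : IsLoop γ) : IsCompact (loopTrace γ) :=
  isCompact_Icc.image_of_continuousOn hγ.continuousOn

theorem mem_loopTrace {γ : ℝ → ℂ} {s : ℝ} (hs : s ∈ Icc (0 : ℝ) 1) : γ s ∈ loopTrace γ :=
  mem_image_of_mem γ hs

theorem ne_zero_of_notMem_loopTrace {γ : ℝ → ℂ} (hγ : IsLoop γ) {z : ℂ}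
    (hz : z ∉ loopTrace γ) : z ≠ 0 := by
  rintro rfl
  exact hz ⟨0, by simp, hγ.start⟩

theorem hasDerivAt_of_contDiffOn_Icc {γ : ℝ → ℂ} {a b s : ℝ} (h : ContDiffOn ℝ 1 γ (Icc a b))
    (hs : s ∈ Ioo a b) : HasDerivAt γ (deriv γ s) s :=
  ((h.contDiffAt (Icc_mem_nhds hs.1 hs.2)).differentiableAt (by norm_num)).hasDerivAt

theorem IsLoop.exists_countable_hasDerivAt {γ : ℝ → ℂ} (hγ : IsLoop γ) :
    ∃ S : Set ℝ, S.Countable ∧ ∀ s ∈ Ioo (0 : ℝ) 1 \ S, HasDerivAt γ (deriv γ s) s := by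
  obtain ⟨k, t, h0, h1, h⟩ := hγ.piecewise_regular
  refine ⟨range t, countable_range t, fun s ⟨hs, hsS⟩ => ?_⟩
  have key : ∀ j ≤ k, s < t j → ∃ i < k, s ∈ Ioo (t i) (t (i + 1)) := by
    intro j
    induction j with
    | zero => intro _ hlt; exact absurd hs.1 (by rw [h0] at hlt; exact not_lt.2 hlt.le)
    | succ j ih =>
      intro hj hlt
      rcases lt_trichotomy s (t j) with hl | he | hg
      · exact ih (by omega) hl
      · exact absurd ⟨j, he.symm⟩ hsS
      · exact ⟨j, by omega, hg, hlt⟩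
  obtain ⟨i, hi, hmem⟩ := key k le_rfl (by rw [h1]; exact hs.2)
  exact hasDerivAt_of_contDiffOn_Icc (h i hi).2.1 hmem

/-- Since each piece is C¹ up to its end points, secant quotients and derivatives have the same
one-sided limit. This makes `γ'` and `γ(s)/s` comparable near the origin. -/
theorem tendsto_slope_and_deriv_right {γ : ℝ → ℂ} {a b : ℝ} (hab : a < b)
    (h : ContDiffOn ℝ 1 γ (Icc a b)) :
    Tendsto (fun s : ℝ => (γ s - γ a) / ((s - a : ℝ) : ℂ)) (𝓝[>] a)
        (𝓝 (derivWithin γ (Icc a b) a)) ∧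
      Tendsto (deriv γ) (𝓝[>] a) (𝓝 (derivWithin γ (Icc a b) a)) := by
  have ha : a ∈ Icc a b := ⟨le_rfl, hab.le⟩
  have hnhds : 𝓝[>] a = 𝓝[Ioo a b] a := (nhdsWithin_Ioo_eq_nhdsGT hab).symm
  constructor
  · have hd := ((h.differentiableOn (by norm_num)) a ha).hasDerivWithinAt
    rw [hasDerivWithinAt_iff_tendsto_slope] at hd
    rw [hnhds]
    refine (hd.mono_left (nhdsWithin_mono _ ?_)).congr' ?_
    · intro x hx
      exact ⟨Ioo_subset_Icc_self hx, by simpa using hx.1.ne'⟩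
    · filter_upwards with s
      rw [slope_def_module, Complex.real_smul, div_eq_inv_mul]
      push_cast
      rfl
  · have hc := h.continuousOn_derivWithin (uniqueDiffOn_Icc hab) le_rfl a ha
    rw [hnhds]
    refine (hc.tendsto.mono_left (nhdsWithin_mono _ Ioo_subset_Icc_self)).congr' ?_
    filter_upwards [self_mem_nhdsWithin] with s hs
    exact derivWithin_of_mem_nhds (Icc_mem_nhds hs.1 hs.2)

/-- Reversing the loop turns its end into a start, so only limits from the right need analysis. -/
theorem contDiffOn_comp_one_sub {γ : ℝ → ℂ} {a b : ℝ} (h : ContDiffOn ℝ 1 γ (Icc a b)) :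
    ContDiffOn ℝ 1 (fun s => γ (1 - s)) (Icc (1 - b) (1 - a)) :=
  h.comp (by fun_prop) fun s hs => ⟨by linarith [hs.2], by linarith [hs.1]⟩

theorem derivWithin_comp_one_sub {γ : ℝ → ℂ} {a b : ℝ} (hab : a < b)
    (h : ContDiffOn ℝ 1 γ (Icc a b)) :
    derivWithin (fun s => γ (1 - s)) (Icc (1 - b) (1 - a)) (1 - b)
      = -derivWithin γ (Icc a b) b := by
  have hb : b ∈ Icc a b := ⟨hab.le, le_rfl⟩
  have hd : HasDerivWithinAt γ (derivWithin γ (Icc a b) b) (Icc a b) (1 - (1 - b)) := by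
    rw [sub_sub_cancel]
    exact ((h.differentiableOn (by norm_num)) b hb).hasDerivWithinAt
  have h1 : HasDerivWithinAt (fun s : ℝ => 1 - s) (-1) (Icc (1 - b) (1 - a)) (1 - b) := by
    simpa using (hasDerivWithinAt_id (1 - b) _).const_sub 1
  have := hd.scomp (1 - b) h1 fun s hs => ⟨by linarith [hs.2], by linarith [hs.1]⟩
  have h2 := this.derivWithin
    (uniqueDiffOn_Icc (by linarith : 1 - b < 1 - a) _ ⟨le_rfl, by linarith⟩)
  simpa [Function.comp_def] using h2

theorem IsLoop.tendsto_start {γ : ℝ → ℂ} (hγ : IsLoop γ) :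
    ∃ v : ℂ, v ≠ 0 ∧ Tendsto (fun s : ℝ => γ s / (s : ℂ)) (𝓝[>] 0) (𝓝 v) ∧
      Tendsto (deriv γ) (𝓝[>] 0) (𝓝 v) := by
  obtain ⟨k, t, h0, h1, h⟩ := hγ.piecewise_regular
  have hk : 0 < k := by
    rcases Nat.eq_zero_or_pos k with rfl | hk
    · rw [h0] at h1; exact absurd h1 zero_ne_one
    · exact hk
  obtain ⟨hlt, hcd, hne⟩ := h 0 hk
  rw [h0] at hlt hcd hne
  obtain ⟨ha, hb⟩ := tendsto_slope_and_deriv_right hlt hcd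
  refine ⟨_, hne 0 ⟨le_rfl, hlt.le⟩, ?_, hb⟩
  simpa [hγ.start] using ha

theorem IsLoop.tendsto_finish {γ : ℝ → ℂ} (hγ : IsLoop γ) :
    ∃ v : ℂ, v ≠ 0 ∧ Tendsto (fun s : ℝ => γ (1 - s) / (s : ℂ)) (𝓝[>] 0) (𝓝 v) ∧
      Tendsto (fun s : ℝ => -deriv γ (1 - s)) (𝓝[>] 0) (𝓝 v) := by
  obtain ⟨k, t, h0, h1, h⟩ := hγ.piecewise_regular
  obtain ⟨k, rfl⟩ : ∃ j, k = j + 1 := by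
    rcases k with _ | k
    · rw [h0] at h1; exact absurd h1 zero_ne_one
    · exact ⟨k, rfl⟩
  obtain ⟨hlt, hcd, hne⟩ := h k (Nat.lt_succ_self k)
  rw [h1] at hlt hcd hne
  have hlt' : (1 - 1 : ℝ) < 1 - t k := by linarith
  obtain ⟨ha, hb⟩ := tendsto_slope_and_deriv_right hlt' (contDiffOn_comp_one_sub hcd)
  rw [derivWithin_comp_one_sub hlt hcd] at ha hb
  refine ⟨_, neg_ne_zero.2 (hne 1 ⟨hlt.le, le_rfl⟩), ?_, ?_⟩
  · simpa [hγ.finish] using ha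
  · have h2 : deriv (fun s => γ (1 - s)) = fun s => -deriv γ (1 - s) := by
      funext s; exact deriv_comp_const_sub _ _ _
    rw [h2] at hb
    simpa using hb

/-- A quantity of exact order `s⁻²` is not integrable at `0`. -/
theorem eq_zero_of_tendsto_sq_mul {g g' w : ℝ → ℂ} {v a : ℂ} {δ : ℝ} (hδ : 0 < δ) (hv : v ≠ 0)
    (hg : Tendsto (fun s : ℝ => g s / (s : ℂ)) (𝓝[>] 0) (𝓝 v))
    (hg' : Tendsto g' (𝓝[>] 0) (𝓝 v))
    (hint : IntegrableOn (fun s => g' s * w s) (Ioc 0 δ))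
    (hlim : Tendsto (fun s => g s ^ 2 * w s) (𝓝[>] 0) (𝓝 a)) : a = 0 := by
  by_contra ha
  have hpos : ∀ᶠ s : ℝ in 𝓝[>] 0, 0 < s := self_mem_nhdsWithin
  have hgne : ∀ᶠ s : ℝ in 𝓝[>] 0, g s ≠ 0 := by
    filter_upwards [hg.eventually_ne hv] with s hs h0
    exact hs (by simp [h0])
  -- Write `s² g' w = (g² w) g' / (g/s)²`; the limit is `a v / v²`.
  have h1 : Tendsto (fun s : ℝ => (s : ℂ) ^ 2 * (g' s * w s)) (𝓝[>] 0) (𝓝 (a / v)) := by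
    have h2 := ((hlim.mul hg').div (hg.pow 2) (pow_ne_zero 2 hv))
    have h3 : a * v / v ^ 2 = a / v := by field_simp
    rw [h3] at h2
    refine h2.congr' ?_
    filter_upwards [hpos, hgne] with s hs hne
    have hs' : (s : ℂ) ≠ 0 := by exact_mod_cast hs.ne'
    simp only [Pi.div_apply]
    field_simp
  have hav : a / v ≠ 0 := div_ne_zero ha hv
  have h2 : Tendsto (fun s : ℝ => (s : ℂ)) (𝓝[>] 0) (𝓝 0) := by
    have : Tendsto (fun s : ℝ => (s : ℂ)) (𝓝 0) (𝓝 ((0 : ℝ) : ℂ)) :=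
      Complex.continuous_ofReal.tendsto 0
    simpa using this.mono_left nhdsWithin_le_nhds
  -- If `a ≠ 0`, then `1/s` is dominated by `g' w`, and the divergence of `log` at `0` contradicts
  -- integrability.
  have hO : deriv Real.log =O[𝓝[>] 0] fun s => g' s * w s := by
    have h4 : Tendsto (fun s : ℝ => (s : ℂ) / ((s : ℂ) ^ 2 * (g' s * w s))) (𝓝[>] 0) (𝓝 0) := by
      simpa [Pi.div_def] using h2.div h1 hav
    have h5 : ∀ᶠ s : ℝ in 𝓝[>] 0, ‖(s : ℂ) / ((s : ℂ) ^ 2 * (g' s * w s))‖ < 1 := by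
      have := h4.norm
      rw [norm_zero] at this
      exact this.eventually_lt_const one_pos
    refine Asymptotics.IsBigO.of_bound 1 ?_
    filter_upwards [h5, hpos, h1.eventually_ne hav] with s hs hs0 hne
    rw [Real.deriv_log, one_mul]
    have hs' : (s : ℂ) ≠ 0 := by exact_mod_cast hs0.ne'
    have hw : g' s * w s ≠ 0 := right_ne_zero_of_mul hne
    have h6 : (s : ℂ) / ((s : ℂ) ^ 2 * (g' s * w s)) = ((s : ℂ)⁻¹) / (g' s * w s) := by
      field_simp
    rw [h6, norm_div, div_lt_one (norm_pos_iff.2 hw)] at hs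
    have h7 : ‖(s : ℂ)⁻¹‖ = ‖s⁻¹‖ := by
      rw [norm_inv, norm_inv, Complex.norm_real]
    rw [← h7]
    exact hs.le
  refine not_integrableOn_of_tendsto_norm_atTop_of_deriv_isBigO_filter (f := Real.log)
    (𝓝[>] (0 : ℝ)) (Ioc_mem_nhdsGT hδ) ?_ ?_ hO hint
  · filter_upwards [hpos] with s hs
    exact Real.differentiableAt_log hs.ne'
  · exact tendsto_abs_atBot_atTop.comp Real.tendsto_log_nhdsGT_zero

/-- A function with integrable derivative has a limit at the left end point. -/
theorem exists_tendsto_of_integrable_deriv {g g' : ℝ → ℂ} {S : Set ℝ} (hS : S.Countable)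
    (hc : ContinuousOn g (Ioo 0 1)) (hd : ∀ s ∈ Ioo (0 : ℝ) 1 \ S, HasDerivAt g (g' s) s)
    (hint : IntervalIntegrable g' volume 0 1) :
    ∃ a, Tendsto g (𝓝[>] 0) (𝓝 a) := by
  have hhalf : IntervalIntegrable g' volume 0 (1 / 2) :=
    hint.mono_set (by
      rw [uIcc_of_le (by norm_num), uIcc_of_le (by norm_num)]
      exact Icc_subset_Icc le_rfl (by norm_num))
  have hcont := intervalIntegral.continuousOn_primitive_interval_left
    ((intervalIntegrable_iff' (by simp)).1 hhalf)
  have h0 := hcont 0 (by simp)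
  have h1 : Tendsto (fun x => ∫ t in x..(1 / 2 : ℝ), g' t) (𝓝[>] 0)
      (𝓝 (∫ t in (0 : ℝ)..(1 / 2), g' t)) := by
    rw [← nhdsWithin_Ioo_eq_nhdsGT (by norm_num : (0 : ℝ) < 1 / 2)]
    refine h0.tendsto.mono_left (nhdsWithin_mono _ ?_)
    rw [uIcc_of_le (by norm_num)]
    exact Ioo_subset_Icc_self
  refine ⟨g (1 / 2) - ∫ t in (0 : ℝ)..(1 / 2), g' t, ?_⟩
  refine (tendsto_const_nhds.sub h1).congr' ?_
  filter_upwards [Ioo_mem_nhdsGT (by norm_num : (0 : ℝ) < 1 / 2)] with x hx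
  have hsub : Icc x (1 / 2) ⊆ Ioo (0 : ℝ) 1 := fun y hy =>
    ⟨hx.1.trans_le hy.1, hy.2.trans_lt (by norm_num)⟩
  have := integral_eq_of_hasDerivAt_off_countable_of_le g g' hx.2.le hS (hc.mono hsub)
    (fun y hy => hd y ⟨hsub (Ioo_subset_Icc_self hy.1), hy.2⟩)
    (hint.mono_set (by
      rw [uIcc_of_le hx.2.le, uIcc_of_le (by norm_num)]
      exact hsub.trans Ioo_subset_Icc_self))
  rw [this]
  ring

theorem tendsto_one_sub_nhdsLT : Tendsto (fun s : ℝ => 1 - s) (𝓝[<] 1) (𝓝[>] 0) := by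
  refine tendsto_nhdsWithin_iff.2 ⟨?_, ?_⟩
  · have : Tendsto (fun s : ℝ => 1 - s) (𝓝 1) (𝓝 (1 - 1)) :=
      (continuous_const.sub continuous_id).tendsto 1
    rw [sub_self] at this
    exact this.mono_left nhdsWithin_le_nhds
  · filter_upwards [self_mem_nhdsWithin] with s hs
    simpa using hs

theorem continuousOn_Icc_of_Ioo_of_tendsto {f : ℝ → ℂ} {a b : ℝ} (hab : a < b)
    (hf : ContinuousOn f (Ioo a b)) (ha : Tendsto f (𝓝[>] a) (𝓝 (f a)))
    (hb : Tendsto f (𝓝[<] b) (𝓝 (f b))) : ContinuousOn f (Icc a b) := by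
  intro x hx
  rcases eq_or_lt_of_le hx.1 with rfl | hax
  · refine (continuousWithinAt_Ioi_iff_Ici.1 ha).mono Icc_subset_Ici_self
  rcases eq_or_lt_of_le hx.2 with rfl | hxb
  · refine (continuousWithinAt_Iio_iff_Iic.1 hb).mono Icc_subset_Iic_self
  · exact (hf.continuousAt (Ioo_mem_nhds hax hxb)).continuousWithinAt

/-- If `γ' w` and the derivative of `γ² w` are integrable, then `γ² w` vanishes at both ends of the
loop, hence is continuous on the closed interval. -/
theorem continuousOn_sq_mul {γ w g' : ℝ → ℂ} (hγ : IsLoop γ) {S : Set ℝ} (hS : S.Countable)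
    (hc : ContinuousOn w (Ioo 0 1))
    (hd : ∀ s ∈ Ioo (0 : ℝ) 1 \ S, HasDerivAt (fun s => γ s ^ 2 * w s) (g' s) s)
    (hw : IntervalIntegrable (fun s => deriv γ s * w s) volume 0 1)
    (hint : IntervalIntegrable g' volume 0 1) :
    ContinuousOn (fun s => γ s ^ 2 * w s) (Icc 0 1) := by
  have hcγ : ContinuousOn (fun s => γ s ^ 2 * w s) (Ioo 0 1) :=
    ((hγ.continuousOn.mono Ioo_subset_Icc_self).pow 2).mul hc
  refine continuousOn_Icc_of_Ioo_of_tendsto one_pos hcγ ?_ ?_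
  · obtain ⟨a, ha⟩ := exists_tendsto_of_integrable_deriv hS hcγ hd hint
    obtain ⟨v, hv, h1, h2⟩ := hγ.tendsto_start
    have := eq_zero_of_tendsto_sq_mul one_pos hv h1 h2
      ((intervalIntegrable_iff_integrableOn_Ioc_of_le zero_le_one).1 hw) ha
    subst this
    simpa [hγ.start] using ha
  -- The right end is the left end of the reversed loop; reversal also changes the sign of the
  -- derivative.
  · have hmaps : MapsTo (fun s : ℝ => 1 - s) (Ioo 0 1) (Ioo 0 1) := fun s hs =>
      ⟨by linarith [hs.2], by linarith [hs.1]⟩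
    have hw' : IntervalIntegrable (fun s => -deriv γ (1 - s) * w (1 - s)) volume 0 1 := by
      simpa [Pi.neg_def] using ((hw.comp_sub_left 1).symm).neg
    have hint' : IntervalIntegrable (fun s => -g' (1 - s)) volume 0 1 := by
      simpa [Pi.neg_def] using ((hint.comp_sub_left 1).symm).neg
    obtain ⟨a, ha⟩ := exists_tendsto_of_integrable_deriv
      (g := fun s => γ (1 - s) ^ 2 * w (1 - s)) (g' := fun s => -g' (1 - s))
      (S := (fun s => 1 - s) ⁻¹' S)
      (hS.preimage sub_right_injective)
      (hcγ.comp (by fun_prop) hmaps)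
      (fun s hs => by
        have h1 := hd (1 - s) ⟨hmaps hs.1, hs.2⟩
        simpa using h1.comp_const_sub 1 s) hint'
    obtain ⟨v, hv, h1, h2⟩ := hγ.tendsto_finish
    have := eq_zero_of_tendsto_sq_mul (g := fun s => γ (1 - s)) (w := fun s => w (1 - s))
      one_pos hv h1 h2
      ((intervalIntegrable_iff_integrableOn_Ioc_of_le zero_le_one).1 hw') ha
    subst this
    have h3 := ha.comp tendsto_one_sub_nhdsLT
    simpa [hγ.finish, Function.comp_def] using h3

/-! ### The weight along the loop and integration by parts -/

/-- Near `s` the continuous branch equals `lgγ s + log (γ x / γ s)` with the principal logarithm: by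
continuity the imaginary part of the increment stays below `1 < π`. -/
theorem IsLogAlong.hasDerivAt {γ lgγ : ℝ → ℂ} (hlg : IsLogAlong γ lgγ)
    {s : ℝ} (hs : s ∈ Ioo (0 : ℝ) 1) {d : ℂ} (hd : HasDerivAt γ d s) :
    HasDerivAt lgγ (d / γ s) s := by
  have hne : γ s ≠ 0 := by rw [← hlg.exp_eq s hs]; exact Complex.exp_ne_zero _
  have hc : ContinuousAt lgγ s := hlg.continuousOn.continuousAt (Ioo_mem_nhds hs.1 hs.2)
  have h1 : HasDerivAt (fun x => lgγ s + Complex.log (γ x / γ s)) (d / γ s) s := by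
    have h2 : HasDerivAt (fun x => γ x / γ s) (d / γ s) s := hd.div_const _
    have h3 := (h2.clog_real (by rw [div_self hne]; exact Complex.one_mem_slitPlane)).const_add
      (lgγ s)
    simpa [div_self hne] using h3
  refine h1.congr_of_eventuallyEq ?_
  have h4 : ∀ᶠ x in 𝓝 s, lgγ x - lgγ s ∈ Metric.ball (0 : ℂ) 1 := by
    have h5 : Tendsto (fun x => lgγ x - lgγ s) (𝓝 s) (𝓝 (lgγ s - lgγ s)) :=
      hc.tendsto.sub_const _
    rw [sub_self] at h5
    exact h5 (Metric.ball_mem_nhds _ one_pos)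
  filter_upwards [h4, Ioo_mem_nhds hs.1 hs.2] with x hx hx1
  have him : |(lgγ x - lgγ s).im| < 1 :=
    (Complex.abs_im_le_norm _).trans_lt (by simpa using hx)
  have hpi : (1 : ℝ) < Real.pi := by linarith [Real.pi_gt_three]
  rw [← hlg.exp_eq x hx1, ← hlg.exp_eq s hs, ← Complex.exp_sub,
    Complex.log_exp (by linarith [(abs_lt.1 him).1]) (by linarith [(abs_lt.1 him).2])]
  ring

theorem hasDerivAt_matDeriv {N : ℕ} {F : ℂ → Mat N}
    (h : ∀ i j, Differentiable ℂ fun w => F w i j) (w : ℂ) (i j : Fin N) :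
    HasDerivAt (fun w => F w i j) (matDeriv F w i j) w :=
  (h i j w).hasDerivAt

variable {N : ℕ}

theorem hasDerivAt_mul_apply {ι : Type} [Fintype ι] {F G : ℂ → Matrix ι ι ℂ}
    {F' G' : Matrix ι ι ℂ} {z : ℂ} (hF : ∀ i j, HasDerivAt (fun x => F x i j) (F' i j) z)
    (hG : ∀ i j, HasDerivAt (fun x => G x i j) (G' i j) z) (i j : ι) :
    HasDerivAt (fun x => (F x * G x) i j) ((F' * G z + F z * G') i j) z := by
  simp only [Matrix.mul_apply, Matrix.add_apply, ← Finset.sum_add_distrib]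
  exact HasDerivAt.fun_sum fun l _ => (hF i l).mul (hG l j)

/-- One factor `γ` clears the denominator of `lgγ' = γ'/γ`; the other is the factor `exp w` in the
Pearson equations written in the logarithmic coordinate. -/
theorem hasDerivAt_weight {hL hR : ℂ → Mat N} {WL WR : ℂ → Mat N} {γ lgγ : ℝ → ℂ} {W : ℂ → Mat N}
    (hlg : IsLogAlong γ lgγ) (hWL : SolvesLeft hL WL) (hWR : SolvesRight hR WR)
    (hfac : Factorises γ lgγ W WL WR) {s : ℝ} (hs : s ∈ Ioo (0 : ℝ) 1) {d : ℂ}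
    (hd : HasDerivAt γ d s) (j k : Fin N) :
    ∃ e : ℂ, HasDerivAt (fun s => W (γ s) j k) e s ∧
      γ s ^ 2 * e = d * (hL (γ s) * W (γ s) + W (γ s) * hR (γ s)) j k := by
  set w := lgγ s with hw
  have hexp : Complex.exp w = γ s := hlg.exp_eq s hs
  have hne : γ s ≠ 0 := by rw [← hexp]; exact Complex.exp_ne_zero _
  have h1 := hasDerivAt_mul_apply (fun i j => hasDerivAt_matDeriv hWL.holomorphic w i j)
    (fun i j => hasDerivAt_matDeriv hWR.holomorphic w i j) j k
  have h2 := h1.comp s (hlg.hasDerivAt hs hd)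
  refine ⟨_, h2.congr_of_eventuallyEq ?_, ?_⟩
  · filter_upwards [Ioo_mem_nhds hs.1 hs.2] with x hx
    simp only [hfac x hx, Function.comp]
  · have h3 : γ s • (matDeriv WL w * WR w + WL w * matDeriv WR w)
        = hL (γ s) * W (γ s) + W (γ s) * hR (γ s) := by
      have e1 := hWL.equation w
      have e2 := hWR.equation w
      rw [hexp] at e1 e2
      rw [smul_add, ← Matrix.smul_mul, ← Matrix.mul_smul, e1, e2, hfac s hs]
      simp only [mul_assoc, ← hw]
    rw [← h3, Matrix.smul_apply, smul_eq_mul]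
    field_simp

theorem continuousOn_weight {hL hR : ℂ → Mat N} {WL WR : ℂ → Mat N} {γ lgγ : ℝ → ℂ}
    {W : ℂ → Mat N} (hlg : IsLogAlong γ lgγ) (hWL : SolvesLeft hL WL) (hWR : SolvesRight hR WR)
    (hfac : Factorises γ lgγ W WL WR) (j k : Fin N) :
    ContinuousOn (fun s => W (γ s) j k) (Ioo 0 1) := by
  have : ContinuousOn (fun s => (WL (lgγ s) * WR (lgγ s)) j k) (Ioo 0 1) := by
    simp only [Matrix.mul_apply]
    exact continuousOn_finsetSum _ fun l _ =>
      ((hWL.holomorphic j l).continuous.comp_continuousOn hlg.continuousOn).mul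
        ((hWR.holomorphic l k).continuous.comp_continuousOn hlg.continuousOn)
  exact this.congr fun s hs => by simp only [hfac s hs]

theorem IsLoop.continuousOn_comp {γ : ℝ → ℂ} (hγ : IsLoop γ) {f : ℂ → ℂ}
    (hf : ContinuousOn f (loopTrace γ)) : ContinuousOn (fun s => f (γ s)) (uIcc 0 1) := by
  rw [uIcc_of_le zero_le_one]
  exact hf.comp hγ.continuousOn (mapsTo_image _ _)

/-- The matrix function `G` is integrable along `γ`, entry by entry. -/
def LoopIntegrable (γ : ℝ → ℂ) (G : ℂ → Mat N) : Prop :=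
  ∀ j k, IntervalIntegrable (fun s => deriv γ s * G (γ s) j k) volume 0 1

theorem LoopIntegrable.add {γ : ℝ → ℂ} {F G : ℂ → Mat N} (hF : LoopIntegrable γ F)
    (hG : LoopIntegrable γ G) : LoopIntegrable γ fun t => F t + G t := fun j k => by
  simpa [mul_add] using (hF j k).add (hG j k)

theorem LoopIntegrable.smul {γ : ℝ → ℂ} (hγ : IsLoop γ) {f : ℂ → ℂ} {G : ℂ → Mat N}
    (hf : ContinuousOn f (loopTrace γ)) (hG : LoopIntegrable γ G) :
    LoopIntegrable γ fun t => f t • G t := fun j k => by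
  have := (hG j k).mul_continuousOn (hγ.continuousOn_comp hf)
  refine this.congr fun s _ => ?_
  simp only [Matrix.smul_apply, smul_eq_mul]
  ring

theorem LoopIntegrable.mul_left {γ : ℝ → ℂ} (hγ : IsLoop γ) {F G : ℂ → Mat N}
    (hF : ∀ i j, ContinuousOn (fun t => F t i j) (loopTrace γ)) (hG : LoopIntegrable γ G) :
    LoopIntegrable γ fun t => F t * G t := fun j k => by
  have := IntervalIntegrable.sum Finset.univ fun l _ =>
    (hG l k).mul_continuousOn (hγ.continuousOn_comp (hF j l))
  refine this.congr fun s _ => ?_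
  simp only [Matrix.mul_apply, Finset.mul_sum, Finset.sum_apply]
  exact Finset.sum_congr rfl fun l _ => by ring

theorem LoopIntegrable.mul_right {γ : ℝ → ℂ} (hγ : IsLoop γ) {F G : ℂ → Mat N}
    (hF : ∀ i j, ContinuousOn (fun t => F t i j) (loopTrace γ)) (hG : LoopIntegrable γ G) :
    LoopIntegrable γ fun t => G t * F t := fun j k => by
  have := IntervalIntegrable.sum Finset.univ fun l _ =>
    (hG j l).mul_continuousOn (hγ.continuousOn_comp (hF l k))
  refine this.congr fun s _ => ?_
  simp only [Matrix.mul_apply, Finset.mul_sum, Finset.sum_apply]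
  exact Finset.sum_congr rfl fun l _ => by ring

/-- Integration by parts along the loop against a weight satisfying the Pearson equation. -/
theorem integral_pearson {hL hR : ℂ → Mat N} {WL WR : ℂ → Mat N} {γ lgγ : ℝ → ℂ} {W : ℂ → Mat N}
    (hγ : IsLoop γ) (hlg : IsLogAlong γ lgγ) (hW : LoopIntegrable γ W)
    (hWL : SolvesLeft hL WL) (hWR : SolvesRight hR WR) (hfac : Factorises γ lgγ W WL WR)
    (hLc : ∀ i j, ContinuousOn (fun t => hL t i j) (loopTrace γ))
    (hRc : ∀ i j, ContinuousOn (fun t => hR t i j) (loopTrace γ))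
    {f f' : ℂ → ℂ} (hf : ∀ t ∈ loopTrace γ, HasDerivAt f (f' t) t)
    (hf' : ContinuousOn f' (loopTrace γ)) (j k : Fin N) :
    ∫ s in (0 : ℝ)..1, deriv γ s * (((2 * γ s * f (γ s) + γ s ^ 2 * f' (γ s)) • W (γ s)
      + f (γ s) • (hL (γ s) * W (γ s) + W (γ s) * hR (γ s))) j k) = 0 := by
  obtain ⟨S, hS, hSd⟩ := hγ.exists_countable_hasDerivAt
  have hfc : ContinuousOn f (loopTrace γ) := fun t ht => (hf t ht).continuousAt.continuousWithinAt
  have hE : LoopIntegrable γ fun t => hL t * W t + W t * hR t :=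
    (hW.mul_left hγ hLc).add (hW.mul_right hγ hRc)
  have hE' : ∀ g g' : ℂ → ℂ, ContinuousOn g (loopTrace γ) → ContinuousOn g' (loopTrace γ) →
      LoopIntegrable γ fun t =>
        (2 * t * g t + t ^ 2 * g' t) • W t + g t • (hL t * W t + W t * hR t) := by
    intro g g' hg hg'
    exact (hW.smul hγ (((continuousOn_const.mul continuousOn_id).mul hg).add
      ((continuousOn_id.pow 2).mul hg'))).add (hE.smul hγ hg)
  have hder : ∀ g g' : ℂ → ℂ, (∀ t ∈ loopTrace γ, HasDerivAt g (g' t) t) →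
      ∀ s ∈ Ioo (0 : ℝ) 1 \ S, HasDerivAt (fun s => g (γ s) * (γ s ^ 2 * W (γ s) j k))
        (deriv γ s * (((2 * γ s * g (γ s) + γ s ^ 2 * g' (γ s)) • W (γ s)
          + g (γ s) • (hL (γ s) * W (γ s) + W (γ s) * hR (γ s))) j k)) s := by
    intro g g' hg s hs
    have hd := hSd s hs
    obtain ⟨e, he, he'⟩ := hasDerivAt_weight hlg hWL hWR hfac hs.1 hd j k
    have h1 := (hg (γ s) (mem_loopTrace (Ioo_subset_Icc_self hs.1))).comp s hd
    have h2 := h1.mul ((hd.pow 2).mul he)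
    refine h2.congr_deriv ?_
    simp only [Matrix.add_apply, Matrix.smul_apply, smul_eq_mul, Pi.pow_apply, Pi.mul_apply,
      Function.comp] at he' ⊢
    rw [he']
    push_cast
    ring
  -- The case `f = 1` comes first: it makes `γ² W` continuous up to the end points, and a general
  -- `f` then only multiplies this function.
  have hone := hder (fun _ => 1) (fun _ => 0) (fun t _ => hasDerivAt_const t 1)
  simp only [one_mul] at hone
  have hcont := continuousOn_sq_mul hγ hS (continuousOn_weight hlg hWL hWR hfac j k) hone
    (hW j k) (by simpa using hE' (fun _ => 1) (fun _ => 0) continuousOn_const continuousOn_const j k)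
  have hcomp := hγ.continuousOn_comp hfc
  rw [uIcc_of_le zero_le_one] at hcomp
  have := integral_eq_of_hasDerivAt_off_countable_of_le _ _ zero_le_one hS (hcomp.mul hcont)
    (hder f f' hf) (hE' f f' hfc hf' j k)
  -- The boundary values contain the factor `γ² = 0`, whatever value `W` takes at the origin.
  rw [this]
  simp [hγ.start, hγ.finish]

open Polynomial

/-! ### Evaluation of matrix polynomials at scalars -/

/-- Evaluation over a noncommutative coefficient ring is multiplicative only at suitable points;
scalar matrices are central, which suffices. -/
theorem scalar_commute (a : Mat N) (z : ℂ) : Commute a (Matrix.scalar (Fin N) z) :=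
  ((Matrix.scalar_commute z (fun r => Commute.all z r) a)).symm

/-- Evaluation at a scalar is a ring homomorphism. -/
def evalHom (z : ℂ) : (Mat N)[X] →+* Mat N :=
  eval₂RingHom' (RingHom.id _) (Matrix.scalar (Fin N) z) fun a => scalar_commute a z

theorem evalAt_add (P Q : (Mat N)[X]) (z : ℂ) : evalAt (P + Q) z = evalAt P z + evalAt Q z :=
  (evalHom z).map_add P Q

theorem evalAt_mul (P Q : (Mat N)[X]) (z : ℂ) : evalAt (P * Q) z = evalAt P z * evalAt Q z :=
  (evalHom z).map_mul P Q

theorem evalAt_sub (P Q : (Mat N)[X]) (z : ℂ) : evalAt (P - Q) z = evalAt P z - evalAt Q z :=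
  (evalHom z).map_sub P Q

theorem evalAt_one (z : ℂ) : evalAt (1 : (Mat N)[X]) z = 1 := (evalHom z).map_one

theorem evalAt_C (a : Mat N) (z : ℂ) : evalAt (C a) z = a := eval_C

theorem evalAt_X (z : ℂ) : evalAt (X : (Mat N)[X]) z = z • 1 := by
  rw [evalAt, eval_X, Matrix.scalar_apply, Matrix.smul_one_eq_diagonal]

theorem evalAt_monomial (n : ℕ) (a : Mat N) (z : ℂ) : evalAt (monomial n a) z = z ^ n • a := by
  rw [evalAt, eval_monomial, ← map_pow, Matrix.scalar_apply, ← Matrix.smul_one_eq_diagonal,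
    mul_smul_comm, mul_one]

theorem hasDerivAt_evalAt (P : (Mat N)[X]) (z : ℂ) (i j : Fin N) :
    HasDerivAt (fun x => evalAt P x i j) (evalAt (derivative P) z i j) z := by
  induction P using Polynomial.induction_on' with
  | add p q hp hq =>
    simp only [derivative_add, evalAt_add, Matrix.add_apply]
    exact hp.add hq
  | monomial n a =>
    simp only [derivative_monomial, evalAt_monomial, Matrix.smul_apply, smul_eq_mul]
    have h := (hasDerivAt_pow n z).mul_const (a i j)
    refine h.congr_deriv ?_
    rw [← nsmul_eq_mul', Matrix.smul_apply, nsmul_eq_mul]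
    ring

theorem continuous_evalAt (P : (Mat N)[X]) (i j : Fin N) : Continuous fun x => evalAt P x i j :=
  continuous_iff_continuousAt.2 fun z => (hasDerivAt_evalAt P z i j).continuousAt

/-- Division by `X - z` for a scalar `z`. -/
theorem exists_eq_C_add_X_sub_mul (P : (Mat N)[X]) (z : ℂ) :
    ∃ Q : (Mat N)[X], P = C (evalAt P z) + (X - C (z • 1)) * Q ∧
      ∀ k, P.natDegree ≤ k + 1 → Q.coeff k = P.coeff (k + 1) := by
  -- The zero ring, where `X - z` does not have degree one, occurs for `N = 0`.
  rcases subsingleton_or_nontrivial (Mat N) with hs | hn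
  · exact ⟨0, Subsingleton.elim _ _, fun k _ => Subsingleton.elim _ _⟩
  set q : (Mat N)[X] := X - C (z • 1) with hq
  have hm : q.Monic := monic_X_sub_C _
  have hdiv := modByMonic_add_div P q
  have hdeg : (P %ₘ q).degree < 1 := by
    have := degree_modByMonic_lt P hm
    rwa [degree_X_sub_C] at this
  have hC : P %ₘ q = C ((P %ₘ q).coeff 0) :=
    eq_C_of_degree_le_zero (Nat.WithBot.lt_one_iff_le_zero.1 hdeg)
  have hval : evalAt P z = (P %ₘ q).coeff 0 := by
    conv_lhs => rw [← hdiv]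
    rw [evalAt_add, evalAt_mul, hq, evalAt_sub, evalAt_X, evalAt_C, sub_self, zero_mul, add_zero,
      ← hq, hC, evalAt_C, coeff_C_zero]
  refine ⟨P /ₘ q, ?_, fun k hk => ?_⟩
  · rw [hval, ← hC, hdiv]
  -- Coefficient `k + 1` of `(X - z) Q` is `Q_k - z Q_{k+1}`, and the last term vanishes by degree.
  · have hz : (P /ₘ q).coeff (k + 1) = 0 := by
      refine coeff_eq_zero_of_natDegree_lt ?_
      rw [natDegree_divByMonic _ hm, natDegree_X_sub_C]
      omega
    conv_rhs => rw [← hdiv, hC]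
    rw [coeff_add, coeff_C_of_ne_zero (Nat.succ_ne_zero k), zero_add, hq, sub_mul, coeff_sub,
      coeff_X_mul, coeff_C_mul, ← hq, hz, mul_zero, sub_zero]

/-! ### Loop integrals -/

theorem loopIntegral_congr {γ : ℝ → ℂ} {F G : ℂ → Mat N} (h : ∀ t ∈ loopTrace γ, F t = G t) :
    loopIntegral γ F = loopIntegral γ G := by
  ext j k
  simp only [loopIntegral, Matrix.of_apply]
  congr 1
  refine intervalIntegral.integral_congr fun s hs => ?_
  rw [uIcc_of_le zero_le_one] at hs
  simp only [h _ (mem_loopTrace hs)]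

theorem loopIntegral_add {γ : ℝ → ℂ} {F G : ℂ → Mat N} (hF : LoopIntegrable γ F)
    (hG : LoopIntegrable γ G) :
    loopIntegral γ (fun t => F t + G t) = loopIntegral γ F + loopIntegral γ G := by
  ext j k
  simp only [loopIntegral, Matrix.of_apply, Matrix.add_apply, mul_add]
  rw [intervalIntegral.integral_add (hF j k) (hG j k), mul_add]

theorem loopIntegral_const_mul {γ : ℝ → ℂ} {G : ℂ → Mat N} (hG : LoopIntegrable γ G) (a : Mat N) :
    loopIntegral γ (fun t => a * G t) = a * loopIntegral γ G := by
  ext j k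
  simp only [loopIntegral, Matrix.of_apply, Matrix.mul_apply, Finset.mul_sum]
  rw [intervalIntegral.integral_finsetSum fun l _ => by
    simpa only [mul_left_comm] using (hG l k).const_mul (a j l), Finset.mul_sum]
  refine Finset.sum_congr rfl fun l _ => ?_
  simp only [mul_left_comm _ (a j l), intervalIntegral.integral_const_mul]

theorem loopIntegral_mul_const {γ : ℝ → ℂ} {G : ℂ → Mat N} (hG : LoopIntegrable γ G) (a : Mat N) :
    loopIntegral γ (fun t => G t * a) = loopIntegral γ G * a := by
  ext j k
  simp only [loopIntegral, Matrix.of_apply, Matrix.mul_apply, Finset.mul_sum]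
  rw [intervalIntegral.integral_finsetSum fun l _ => by
    simpa only [mul_assoc] using (hG j l).mul_const (a l k), Finset.mul_sum]
  refine Finset.sum_congr rfl fun l _ => ?_
  simp only [← mul_assoc, intervalIntegral.integral_mul_const]

theorem loopIntegral_smul {γ : ℝ → ℂ} {G : ℂ → Mat N} (c : ℂ) :
    loopIntegral γ (fun t => c • G t) = c • loopIntegral γ G := by
  ext j k
  simp only [loopIntegral, Matrix.of_apply, Matrix.smul_apply, smul_eq_mul]
  simp only [mul_left_comm _ c, intervalIntegral.integral_const_mul]

/-! ### The pairing of matrix polynomials -/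

/-- The pairing `∫_γ φ P W R dz / (2πi)`. -/
def pairing (γ : ℝ → ℂ) (W : ℂ → Mat N) (φ : ℂ → ℂ) (P R : (Mat N)[X]) : Mat N :=
  loopIntegral γ fun t => φ t • (evalAt P t * W t * evalAt R t)

section pairing

variable {γ : ℝ → ℂ} {W : ℂ → Mat N} {φ ψ : ℂ → ℂ}

theorem loopIntegrable_pairing (hγ : IsLoop γ) (hW : LoopIntegrable γ W)
    (hφ : ContinuousOn φ (loopTrace γ)) (P R : (Mat N)[X]) :
    LoopIntegrable γ fun t => φ t • (evalAt P t * W t * evalAt R t) :=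
  ((hW.mul_left hγ fun i j => (continuous_evalAt P i j).continuousOn).mul_right hγ
    fun i j => (continuous_evalAt R i j).continuousOn).smul hγ hφ

theorem pairing_congr (h : ∀ t ∈ loopTrace γ, φ t = ψ t) (P R : (Mat N)[X]) :
    pairing γ W φ P R = pairing γ W ψ P R :=
  loopIntegral_congr fun t ht => by rw [h t ht]

theorem pairing_add_fun (hγ : IsLoop γ) (hW : LoopIntegrable γ W)
    (hφ : ContinuousOn φ (loopTrace γ)) (hψ : ContinuousOn ψ (loopTrace γ)) (P R : (Mat N)[X]) :
    pairing γ W (fun t => φ t + ψ t) P R = pairing γ W φ P R + pairing γ W ψ P R := by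
  unfold pairing
  rw [← loopIntegral_add (loopIntegrable_pairing hγ hW hφ P R)
    (loopIntegrable_pairing hγ hW hψ P R)]
  simp only [add_smul]

theorem pairing_smul_fun (c : ℂ) (P R : (Mat N)[X]) :
    pairing γ W (fun t => c * φ t) P R = c • pairing γ W φ P R := by
  unfold pairing
  rw [← loopIntegral_smul]
  simp only [mul_smul]

theorem pairing_add_left (hγ : IsLoop γ) (hW : LoopIntegrable γ W)
    (hφ : ContinuousOn φ (loopTrace γ)) (P Q R : (Mat N)[X]) :
    pairing γ W φ (P + Q) R = pairing γ W φ P R + pairing γ W φ Q R := by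
  unfold pairing
  rw [← loopIntegral_add (loopIntegrable_pairing hγ hW hφ P R)
    (loopIntegrable_pairing hγ hW hφ Q R)]
  simp only [evalAt_add, add_mul, smul_add]

theorem pairing_add_right (hγ : IsLoop γ) (hW : LoopIntegrable γ W)
    (hφ : ContinuousOn φ (loopTrace γ)) (P Q R : (Mat N)[X]) :
    pairing γ W φ P (Q + R) = pairing γ W φ P Q + pairing γ W φ P R := by
  unfold pairing
  rw [← loopIntegral_add (loopIntegrable_pairing hγ hW hφ P Q)
    (loopIntegrable_pairing hγ hW hφ P R)]
  simp only [evalAt_add, mul_add, smul_add]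

theorem pairing_C_mul (hγ : IsLoop γ) (hW : LoopIntegrable γ W)
    (hφ : ContinuousOn φ (loopTrace γ)) (a : Mat N) (P R : (Mat N)[X]) :
    pairing γ W φ (C a * P) R = a * pairing γ W φ P R := by
  unfold pairing
  rw [← loopIntegral_const_mul (loopIntegrable_pairing hγ hW hφ P R)]
  simp only [evalAt_mul, evalAt_C, mul_smul_comm, mul_assoc]

theorem pairing_mul_C (hγ : IsLoop γ) (hW : LoopIntegrable γ W)
    (hφ : ContinuousOn φ (loopTrace γ)) (a : Mat N) (P R : (Mat N)[X]) :
    pairing γ W φ P (R * C a) = pairing γ W φ P R * a := by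
  unfold pairing
  rw [← loopIntegral_mul_const (loopIntegrable_pairing hγ hW hφ P R)]
  simp only [evalAt_mul, evalAt_C, smul_mul_assoc, mul_assoc]

theorem pairing_X_mul_left (P R : (Mat N)[X]) :
    pairing γ W φ (X * P) R = pairing γ W (fun t => t * φ t) P R :=
  loopIntegral_congr fun t _ => by
    rw [evalAt_mul, evalAt_X, smul_mul_assoc, one_mul, smul_mul_assoc, smul_mul_assoc, smul_smul,
      mul_comm]

theorem pairing_zero_left (R : (Mat N)[X]) : pairing γ W φ 0 R = 0 := by
  ext j k
  simp [pairing, loopIntegral, evalAt]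

theorem pairing_neg_left (hγ : IsLoop γ) (hW : LoopIntegrable γ W)
    (hφ : ContinuousOn φ (loopTrace γ)) (P R : (Mat N)[X]) :
    pairing γ W φ (-P) R = -pairing γ W φ P R := by
  have := pairing_add_left hγ hW hφ P (-P) R
  rw [add_neg_cancel, pairing_zero_left] at this
  exact eq_neg_of_add_eq_zero_right this.symm

theorem pairing_sub_left (hγ : IsLoop γ) (hW : LoopIntegrable γ W)
    (hφ : ContinuousOn φ (loopTrace γ)) (P Q R : (Mat N)[X]) :
    pairing γ W φ (P - Q) R = pairing γ W φ P R - pairing γ W φ Q R := by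
  rw [sub_eq_add_neg, pairing_add_left hγ hW hφ, pairing_neg_left hγ hW hφ, sub_eq_add_neg]

theorem pairing_X_pow_right (P : (Mat N)[X]) (k : ℕ) :
    pairing γ W (fun _ => 1) P (X ^ k) = pairing γ W (fun t => t ^ k) P 1 := by
  refine loopIntegral_congr fun t _ => ?_
  rw [evalAt_one, mul_one, one_smul, ← one_mul ((X : (Mat N)[X]) ^ k), ← C_1, C_mul_X_pow_eq_monomial,
    evalAt_monomial, mul_smul_comm, mul_one]

theorem pairing_X_pow_left (R : (Mat N)[X]) (k : ℕ) :
    pairing γ W (fun _ => 1) (X ^ k) R = pairing γ W (fun t => t ^ k) 1 R := by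
  refine loopIntegral_congr fun t _ => ?_
  rw [evalAt_one, one_mul, one_smul, ← one_mul ((X : (Mat N)[X]) ^ k), ← C_1, C_mul_X_pow_eq_monomial,
    evalAt_monomial, smul_mul_assoc, smul_mul_assoc, one_mul]

theorem secondKindL_eq (P : (Mat N)[X]) (z : ℂ) :
    secondKindL γ W P z = pairing γ W (fun t => (t - z)⁻¹) P 1 :=
  loopIntegral_congr fun t _ => by rw [evalAt_one, mul_one]

theorem secondKindR_eq (P : (Mat N)[X]) (z : ℂ) :
    secondKindR γ W P z = pairing γ W (fun t => (t - z)⁻¹) 1 P :=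
  loopIntegral_congr fun t _ => by rw [evalAt_one, one_mul]

theorem continuousOn_sub_inv {z : ℂ} (hz : z ∉ loopTrace γ) :
    ContinuousOn (fun t => (t - z)⁻¹) (loopTrace γ) :=
  (continuousOn_id.sub continuousOn_const).inv₀ fun t ht => sub_ne_zero.2 fun h =>
    hz ((show t = z from h) ▸ ht)

/-- `∫ P W/(t-z) · R(z)` in terms of `∫ P W R/(t-z)`. -/
theorem exists_secondKindL_mul (hγ : IsLoop γ) (hW : LoopIntegrable γ W) {z : ℂ}
    (hz : z ∉ loopTrace γ) (P R : (Mat N)[X]) :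
    ∃ Q : (Mat N)[X], (∀ k, R.natDegree ≤ k + 1 → Q.coeff k = R.coeff (k + 1)) ∧
      secondKindL γ W P z * evalAt R z
        = pairing γ W (fun t => (t - z)⁻¹) P R - pairing γ W (fun _ => 1) P Q := by
  obtain ⟨Q, hQ, hc⟩ := exists_eq_C_add_X_sub_mul R z
  refine ⟨Q, hc, ?_⟩
  have h1 : pairing γ W (fun t => (t - z)⁻¹) P ((X - C (z • 1)) * Q)
      = pairing γ W (fun _ => 1) P Q := by
    refine loopIntegral_congr fun t ht => ?_
    have : t - z ≠ 0 := sub_ne_zero.2 fun h => hz (h ▸ ht)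
    rw [evalAt_mul, evalAt_sub, evalAt_X, evalAt_C, ← sub_smul, smul_mul_assoc, one_mul,
      mul_smul_comm, smul_smul, inv_mul_cancel₀ this]
  have h2 := congrArg (pairing γ W (fun t => (t - z)⁻¹) P) hQ
  rw [pairing_add_right hγ hW (continuousOn_sub_inv hz), h1, ← one_mul (C (evalAt R z)),
    pairing_mul_C hγ hW (continuousOn_sub_inv hz), ← secondKindL_eq] at h2
  rw [h2, add_sub_cancel_right]

/-- Substitute `P(t) = P(z) + (t - z) Q(t)` under the integral. Only the high coefficients of `Q`
are recorded, because biorthogonality needs no others. -/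
theorem exists_mul_secondKindR (hγ : IsLoop γ) (hW : LoopIntegrable γ W) {z : ℂ}
    (hz : z ∉ loopTrace γ) (P R : (Mat N)[X]) :
    ∃ Q : (Mat N)[X], (∀ k, P.natDegree ≤ k + 1 → Q.coeff k = P.coeff (k + 1)) ∧
      evalAt P z * secondKindR γ W R z
        = pairing γ W (fun t => (t - z)⁻¹) P R - pairing γ W (fun _ => 1) Q R := by
  obtain ⟨Q, hQ, hc⟩ := exists_eq_C_add_X_sub_mul P z
  refine ⟨Q, hc, ?_⟩
  have h1 : pairing γ W (fun t => (t - z)⁻¹) ((X - C (z • 1)) * Q) R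
      = pairing γ W (fun _ => 1) Q R := by
    refine loopIntegral_congr fun t ht => ?_
    have : t - z ≠ 0 := sub_ne_zero.2 fun h => hz (h ▸ ht)
    rw [evalAt_mul, evalAt_sub, evalAt_X, evalAt_C, ← sub_smul, smul_mul_assoc, one_mul,
      smul_mul_assoc, smul_mul_assoc, smul_smul, inv_mul_cancel₀ this]
  have h2 := congrArg (fun P => pairing γ W (fun t => (t - z)⁻¹) P R) hQ
  beta_reduce at h2
  rw [pairing_add_left hγ hW (continuousOn_sub_inv hz), h1, ← mul_one (C (evalAt P z)),
    pairing_C_mul hγ hW (continuousOn_sub_inv hz), ← secondKindR_eq] at h2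
  rw [h2, add_sub_cancel_right]

end pairing

/-! ### The Pearson operator -/

/-- The operator `P ↦ z² P' + P (A z + B)` on matrix polynomials. -/
def pearsonOp (A B : Mat N) (P : (Mat N)[X]) : (Mat N)[X] :=
  X * (X * derivative P) + P * (X * C A + C B)

theorem evalAt_pearsonOp (A B : Mat N) (P : (Mat N)[X]) (z : ℂ) :
    evalAt (pearsonOp A B P) z
      = z ^ 2 • evalAt (derivative P) z + evalAt P z * (z • A + B) := by
  simp only [pearsonOp, evalAt_add, evalAt_mul, evalAt_X, evalAt_C, smul_mul_assoc, one_mul,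
    smul_smul, sq]

theorem coeff_pearsonOp_succ (A B : Mat N) (P : (Mat N)[X]) (j : ℕ) :
    (pearsonOp A B P).coeff (j + 1)
      = (j : ℂ) • P.coeff j + P.coeff j * A + P.coeff (j + 1) * B := by
  have h1 : (X * derivative P).coeff j = (j : ℂ) • P.coeff j := by
    rcases j with _ | j
    · simp
    · rw [coeff_X_mul, coeff_derivative]
      have : ((j : Mat N) + 1) = ((j + 1 : ℕ) : Mat N) := by push_cast; rfl
      rw [this, ← nsmul_eq_mul', Nat.cast_smul_eq_nsmul]
  rw [pearsonOp, coeff_add, coeff_X_mul, h1, mul_add, coeff_add, coeff_mul_C, ← mul_assoc,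
    coeff_mul_C, coeff_mul_X]
  abel

section pearson

variable {γ lgγ : ℝ → ℂ} {W WL WR : ℂ → Mat N} {AL BL AR BR : Mat N}

theorem continuous_affine (A B : Mat N) (i j : Fin N) :
    Continuous fun t : ℂ => (t • A + B) i j := by
  simp only [Matrix.add_apply, Matrix.smul_apply, smul_eq_mul]
  fun_prop

/-- Integration by parts moves the derivative from `P` to `φ W`. In `W'`, the `h^L` part is absorbed
into the operator acting on `P`, while the `h^R` part leaves the integral on the right. -/
theorem pairing_pearsonOp (hγ : IsLoop γ) (hlg : IsLogAlong γ lgγ) (hW : LoopIntegrable γ W)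
    (hWL : SolvesLeft (fun z => z • AL + BL) WL) (hWR : SolvesRight (fun z => z • AR + BR) WR)
    (hfac : Factorises γ lgγ W WL WR) {φ φ' : ℂ → ℂ}
    (hφ : ∀ t ∈ loopTrace γ, HasDerivAt φ (φ' t) t) (hφ' : ContinuousOn φ' (loopTrace γ))
    (P : (Mat N)[X]) :
    pairing γ W φ (pearsonOp AL BL P) 1
      = -pairing γ W (fun t => 2 * t * φ t + t ^ 2 * φ' t) P 1
        - pairing γ W (fun t => t * φ t) P 1 * AR - pairing γ W φ P 1 * BR := by
  have hφc : ContinuousOn φ (loopTrace γ) := fun t ht => (hφ t ht).continuousAt.continuousWithinAt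
  have htφ : ContinuousOn (fun t => t * φ t) (loopTrace γ) := continuousOn_id.mul hφc
  have hχ : ContinuousOn (fun t => 2 * t * φ t + t ^ 2 * φ' t) (loopTrace γ) :=
    ((continuousOn_const.mul continuousOn_id).mul hφc).add ((continuousOn_id.pow 2).mul hφ')
  have hint := fun (ψ : ℂ → ℂ) (h : ContinuousOn ψ (loopTrace γ)) (P R : (Mat N)[X]) =>
    loopIntegrable_pairing hγ hW h P R
  -- Right factors are encoded as constant polynomials, so that all terms merge into a single loop
  -- integral.
  suffices h : pairing γ W φ (pearsonOp AL BL P) 1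
      + pairing γ W (fun t => 2 * t * φ t + t ^ 2 * φ' t) P 1
      + pairing γ W (fun t => t * φ t) P (1 * C AR) + pairing γ W φ P (1 * C BR) = 0 by
    rw [pairing_mul_C hγ hW htφ, pairing_mul_C hγ hW hφc] at h
    rw [← sub_eq_zero, ← h]
    abel
  have hLc : ∀ i j, ContinuousOn (fun t : ℂ => (t • AL + BL) i j) (loopTrace γ) :=
    fun i j => (continuous_affine AL BL i j).continuousOn
  have hRc : ∀ i j, ContinuousOn (fun t : ℂ => (t • AR + BR) i j) (loopTrace γ) :=
    fun i j => (continuous_affine AR BR i j).continuousOn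
  unfold pairing
  rw [← loopIntegral_add (hint _ hφc _ _) (hint _ hχ _ _),
    ← loopIntegral_add ((hint _ hφc _ _).add (hint _ hχ _ _)) (hint _ htφ _ _),
    ← loopIntegral_add (((hint _ hφc _ _).add (hint _ hχ _ _)).add (hint _ htφ _ _))
      (hint _ hφc _ _)]
  have hE : LoopIntegrable γ fun t => (t • AL + BL) * W t + W t * (t • AR + BR) :=
    (hW.mul_left hγ hLc).add (hW.mul_right hγ hRc)
  have hf : ∀ i l, ∀ t ∈ loopTrace γ, HasDerivAt (fun t => φ t * evalAt P t i l)
      (φ' t * evalAt P t i l + φ t * evalAt (derivative P) t i l) t := fun i l t ht =>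
    (hφ t ht).mul (hasDerivAt_evalAt P t i l)
  have hf' : ∀ i l, ContinuousOn
      (fun t => φ' t * evalAt P t i l + φ t * evalAt (derivative P) t i l) (loopTrace γ) :=
    fun i l => (hφ'.mul (continuous_evalAt P i l).continuousOn).add
      (hφc.mul (continuous_evalAt (derivative P) i l).continuousOn)
  ext i k
  simp only [loopIntegral, Matrix.of_apply, Matrix.zero_apply]
  -- The scalar identity is applied with `f = φ P_{il}` to the entry `(l, k)` of the weight, then
  -- summed over `l` to form the matrix product.
  have hzero : ∑ l, ∫ s in (0 : ℝ)..1, deriv γ s *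
      (((2 * γ s * (φ (γ s) * evalAt P (γ s) i l) + γ s ^ 2 *
        (φ' (γ s) * evalAt P (γ s) i l + φ (γ s) * evalAt (derivative P) (γ s) i l)) • W (γ s)
        + (φ (γ s) * evalAt P (γ s) i l) •
          ((γ s • AL + BL) * W (γ s) + W (γ s) * (γ s • AR + BR))) l k) = 0 :=
    Finset.sum_eq_zero fun l _ =>
      integral_pearson hγ hlg hW hWL hWR hfac hLc hRc (hf i l) (hf' i l) l k
  rw [← intervalIntegral.integral_finsetSum] at hzero
  · rw [mul_eq_zero]
    right
    rw [← hzero]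
    refine intervalIntegral.integral_congr fun s _ => ?_
    rw [← Finset.mul_sum]
    congr 1
    have hmat : φ (γ s) • (evalAt (pearsonOp AL BL P) (γ s) * W (γ s) * evalAt 1 (γ s))
        + (2 * γ s * φ (γ s) + γ s ^ 2 * φ' (γ s)) • (evalAt P (γ s) * W (γ s) * evalAt 1 (γ s))
        + (γ s * φ (γ s)) • (evalAt P (γ s) * W (γ s) * evalAt (1 * C AR) (γ s))
        + φ (γ s) • (evalAt P (γ s) * W (γ s) * evalAt (1 * C BR) (γ s))
        = (2 * γ s * φ (γ s) + γ s ^ 2 * φ' (γ s)) • (evalAt P (γ s) * W (γ s))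
          + (γ s ^ 2 * φ (γ s)) • (evalAt (derivative P) (γ s) * W (γ s))
          + φ (γ s) • (evalAt P (γ s) *
            ((γ s • AL + BL) * W (γ s) + W (γ s) * (γ s • AR + BR))) := by
      simp only [one_mul, evalAt_one, evalAt_C, mul_one, evalAt_pearsonOp, add_mul, mul_add,
        smul_mul_assoc, mul_smul_comm, mul_assoc]
      module
    rw [hmat]
    generalize (γ s • AL + BL) * W (γ s) + W (γ s) * (γ s • AR + BR) = M
    simp only [Matrix.add_apply, Matrix.smul_apply, Matrix.mul_apply, smul_eq_mul, Finset.mul_sum,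
      ← Finset.sum_add_distrib]
    exact Finset.sum_congr rfl fun l _ => by ring
  · intro l _
    exact ((hW.smul hγ (((continuousOn_const.mul continuousOn_id).mul
      (hφc.mul (continuous_evalAt P i l).continuousOn)).add
      ((continuousOn_id.pow 2).mul (hf' i l)))).add
      (hE.smul hγ (hφc.mul (continuous_evalAt P i l).continuousOn))) l k

/-! ### Moments of polynomials -/

/-- `∫_γ t^k P W dt / (2πi)`. -/
def polyMoment (γ : ℝ → ℂ) (W : ℂ → Mat N) (k : ℕ) (P : (Mat N)[X]) : Mat N :=
  pairing γ W (fun t => t ^ k) P 1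

theorem continuousOn_pow_id (k : ℕ) (s : Set ℂ) : ContinuousOn (fun t : ℂ => t ^ k) s :=
  (continuous_pow k).continuousOn

theorem polyMoment_add (hγ : IsLoop γ) (hW : LoopIntegrable γ W) (k : ℕ) (P Q : (Mat N)[X]) :
    polyMoment γ W k (P + Q) = polyMoment γ W k P + polyMoment γ W k Q :=
  pairing_add_left hγ hW (continuousOn_pow_id k _) P Q 1

theorem polyMoment_sub (hγ : IsLoop γ) (hW : LoopIntegrable γ W) (k : ℕ) (P Q : (Mat N)[X]) :
    polyMoment γ W k (P - Q) = polyMoment γ W k P - polyMoment γ W k Q :=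
  pairing_sub_left hγ hW (continuousOn_pow_id k _) P Q 1

theorem polyMoment_C_mul (hγ : IsLoop γ) (hW : LoopIntegrable γ W) (k : ℕ) (a : Mat N)
    (P : (Mat N)[X]) : polyMoment γ W k (C a * P) = a * polyMoment γ W k P :=
  pairing_C_mul hγ hW (continuousOn_pow_id k _) a P 1

theorem polyMoment_X_mul (k : ℕ) (P : (Mat N)[X]) :
    polyMoment γ W k (X * P) = polyMoment γ W (k + 1) P := by
  rw [polyMoment, pairing_X_mul_left]
  exact pairing_congr (fun t _ => (pow_succ' t k).symm) P 1

/-- Taking `φ = t^k` leaves only moments `k` and `k + 1` of `P`, so the operator costs one order of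
orthogonality. -/
theorem polyMoment_pearsonOp (hγ : IsLoop γ) (hlg : IsLogAlong γ lgγ) (hW : LoopIntegrable γ W)
    (hWL : SolvesLeft (fun z => z • AL + BL) WL) (hWR : SolvesRight (fun z => z • AR + BR) WR)
    (hfac : Factorises γ lgγ W WL WR) (k : ℕ) (P : (Mat N)[X]) :
    polyMoment γ W k (pearsonOp AL BL P)
      = -(((k : ℂ) + 2) • polyMoment γ W (k + 1) P) - polyMoment γ W (k + 1) P * AR
        - polyMoment γ W k P * BR := by
  have h := pairing_pearsonOp hγ hlg hW hWL hWR hfac (φ := fun t => t ^ k)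
    (φ' := fun t => k * t ^ (k - 1)) (fun t _ => hasDerivAt_pow k t)
    (continuous_const.mul (continuous_pow _)).continuousOn P
  rw [pairing_congr (ψ := fun t => ((k : ℂ) + 2) * t ^ (k + 1)) (fun t _ => ?_) P 1,
    pairing_congr (φ := fun t => t * t ^ k) (ψ := fun t => t ^ (k + 1))
      (fun t _ => (pow_succ' t k).symm) P 1, pairing_smul_fun] at h
  · exact h
  -- The truncated exponent `k - 1` is harmless at `k = 0`, where the factor `k` vanishes.
  · rcases k with _ | k
    · simp
    · simp only [Nat.add_sub_cancel]; push_cast; ring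

end pearson

/-! ### Biorthogonality -/

section biorthogonal

variable {γ : ℝ → ℂ} {W : ℂ → Mat N} {PL PR : ℕ → (Mat N)[X]} {Cn : ℕ → Mat N}

theorem coeff_self {P : ℕ → (Mat N)[X]} (hm : ∀ n, (P n).Monic) (hd : ∀ n, (P n).natDegree = n)
    (n : ℕ) : (P n).coeff n = 1 := by
  have := (hm n).coeff_natDegree
  rwa [hd n] at this

theorem nextCoeff_succ {P : ℕ → (Mat N)[X]} (hd : ∀ n, (P n).natDegree = n)
    (n : ℕ) : (P (n + 1)).nextCoeff = (P (n + 1)).coeff n := by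
  rw [nextCoeff_of_natDegree_pos (by rw [hd]; omega), hd, Nat.add_sub_cancel]

theorem coeff_eq_zero_of_lt {P : ℕ → (Mat N)[X]} (hd : ∀ n, (P n).natDegree = n)
    {n k : ℕ} (h : n < k) : (P n).coeff k = 0 :=
  coeff_eq_zero_of_natDegree_lt (by rwa [hd])

theorem eq_one_of_index_zero {P : ℕ → (Mat N)[X]} (hm : ∀ n, (P n).Monic)
    (hd : ∀ n, (P n).natDegree = n) : P 0 = 1 :=
  (hm 0).natDegree_eq_zero.1 (hd 0)

theorem eq_sum_X_pow_mul_C {P : (Mat N)[X]} {n : ℕ} (h : P.natDegree ≤ n) :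
    P = ∑ k ∈ Finset.range (n + 1), X ^ k * C (P.coeff k) := by
  conv_lhs => rw [P.as_sum_range_C_mul_X_pow' (Nat.lt_succ_of_le h)]
  simp only [X_pow_mul_C]

theorem pairing_sum_right_one (hγ : IsLoop γ) (hW : LoopIntegrable γ W) {R : (Mat N)[X]} {n : ℕ}
    (h : R.natDegree ≤ n) (P : (Mat N)[X]) :
    pairing γ W (fun _ => 1) P R
      = ∑ k ∈ Finset.range (n + 1), polyMoment γ W k P * R.coeff k := by
  conv_lhs => rw [eq_sum_X_pow_mul_C h]
  refine (map_sum (AddMonoidHom.mk' (pairing γ W (fun _ => 1) P)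
    (pairing_add_right hγ hW continuousOn_const P)) _ _).trans (Finset.sum_congr rfl fun k _ => ?_)
  rw [AddMonoidHom.mk'_apply]
  rw [pairing_mul_C hγ hW continuousOn_const, pairing_X_pow_right, polyMoment]

theorem pairing_sum_left_one (hγ : IsLoop γ) (hW : LoopIntegrable γ W) {P : (Mat N)[X]} {n : ℕ}
    (h : P.natDegree ≤ n) (R : (Mat N)[X]) :
    pairing γ W (fun _ => 1) P R
      = ∑ k ∈ Finset.range (n + 1), P.coeff k * pairing γ W (fun t => t ^ k) 1 R := by
  conv_lhs => rw [eq_sum_X_pow_mul_C h]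
  refine (map_sum (AddMonoidHom.mk' (fun P => pairing γ W (fun _ => 1) P R)
    fun P Q => pairing_add_left hγ hW continuousOn_const P Q R) _ _).trans
    (Finset.sum_congr rfl fun k _ => ?_)
  rw [AddMonoidHom.mk'_apply, X_pow_mul_C, pairing_C_mul hγ hW continuousOn_const, pairing_X_pow_left]

theorem polyMoment_left (hP : IsBiorthogonalSystem γ W PL PR Cn) {n k : ℕ} (h : k ≤ n) :
    polyMoment γ W k (PL n) = if n = k then (Cn n)⁻¹ else 0 := by
  rw [← hP.orthogonalL n k h, polyMoment, pairing]
  exact loopIntegral_congr fun t _ => by rw [evalAt_one, mul_one]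

theorem pairing_pow_right (hP : IsBiorthogonalSystem γ W PL PR Cn) {n k : ℕ} (h : k ≤ n) :
    pairing γ W (fun t => t ^ k) 1 (PR n) = if n = k then (Cn n)⁻¹ else 0 := by
  rw [← hP.orthogonalR n k h, pairing]
  exact loopIntegral_congr fun t _ => by rw [evalAt_one, one_mul]

/-- Expanding `R` in powers, orthogonality removes every term except that of degree `n`. -/
theorem pairing_left (hγ : IsLoop γ) (hW : LoopIntegrable γ W)
    (hP : IsBiorthogonalSystem γ W PL PR Cn) {n : ℕ} {R : (Mat N)[X]} (h : R.natDegree ≤ n) :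
    pairing γ W (fun _ => 1) (PL n) R = (Cn n)⁻¹ * R.coeff n := by
  rw [pairing_sum_right_one hγ hW h, Finset.sum_eq_single n]
  · rw [polyMoment_left hP le_rfl, if_pos rfl]
  · intro k hk hne
    rw [polyMoment_left hP (Nat.lt_succ_iff.1 (Finset.mem_range.1 hk)), if_neg hne.symm, zero_mul]
  · intro hn
    exact absurd (Finset.self_mem_range_succ n) hn

theorem pairing_right (hγ : IsLoop γ) (hW : LoopIntegrable γ W)
    (hP : IsBiorthogonalSystem γ W PL PR Cn) {n : ℕ} {P : (Mat N)[X]} (h : P.natDegree ≤ n) :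
    pairing γ W (fun _ => 1) P (PR n) = P.coeff n * (Cn n)⁻¹ := by
  rw [pairing_sum_left_one hγ hW h, Finset.sum_eq_single n]
  · rw [pairing_pow_right hP le_rfl, if_pos rfl]
  · intro k hk hne
    rw [pairing_pow_right hP (Nat.lt_succ_iff.1 (Finset.mem_range.1 hk)), if_neg hne.symm, mul_zero]
  · intro hn
    exact absurd (Finset.self_mem_range_succ n) hn

/-- A polynomial of degree less than `n` with `n` vanishing moments is zero. -/
theorem eq_zero_of_polyMoment (hγ : IsLoop γ) (hW : LoopIntegrable γ W)
    (hP : IsBiorthogonalSystem γ W PL PR Cn) {n : ℕ} {R : (Mat N)[X]}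
    (hdeg : ∀ k, n ≤ k → R.coeff k = 0) (hmom : ∀ k < n, polyMoment γ W k R = 0) : R = 0 := by
  induction n with
  | zero => ext1 k; exact hdeg k (Nat.zero_le k)
  | succ n ih =>
    refine ih (fun k hk => ?_) fun k hk => hmom k (by omega)
    rcases eq_or_lt_of_le hk with rfl | hlt
    · have hd : R.natDegree ≤ n := natDegree_le_iff_coeff_eq_zero.2 fun k hk => hdeg k hk
      -- The pairing of `R` with `PR n` is computed twice: right orthogonality gives the top
      -- coefficient of `R` times `C_n⁻¹`, and expanding `PR n` in powers gives zero.
      have h1 := pairing_right hγ hW hP hd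
      rw [pairing_sum_right_one hγ hW (hP.degreeR n).le, Finset.sum_eq_zero] at h1
      · have h2 := congrArg (· * Cn n) h1
        simpa [mul_assoc, Matrix.nonsing_inv_mul _ (hP.nonsingular n)] using h2.symm
      · intro k hk
        rw [hmom k (Finset.mem_range.1 hk), zero_mul]
    · exact hdeg k hlt

/-- By degree, `PL n` pairs to zero with `PR (n + 1)`. Expanding the latter in powers leaves only
moments `n` and `n + 1`. This is how the subleading right coefficient enters relations between left
polynomials. -/
theorem polyMoment_left_succ (hγ : IsLoop γ) (hW : LoopIntegrable γ W)
    (hP : IsBiorthogonalSystem γ W PL PR Cn) (n : ℕ) :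
    polyMoment γ W (n + 1) (PL n) = -((Cn n)⁻¹ * (PR (n + 1)).nextCoeff) := by
  have h1 := pairing_right hγ hW hP (n := n + 1) (P := PL n) (by rw [hP.degreeL]; omega)
  rw [coeff_eq_zero_of_lt hP.degreeL (Nat.lt_succ_self n), zero_mul,
    pairing_sum_right_one hγ hW (hP.degreeR (n + 1)).le, Finset.sum_range_succ,
    Finset.sum_range_succ, Finset.sum_eq_zero, zero_add, polyMoment_left hP le_rfl, if_pos rfl,
    coeff_self hP.monicR hP.degreeR, mul_one, ← nextCoeff_succ hP.degreeR] at h1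
  · exact eq_neg_of_add_eq_zero_right h1
  · intro k hk
    have hk := Finset.mem_range.1 hk
    rw [polyMoment_left hP hk.le, if_neg hk.ne', zero_mul]

end biorthogonal

section structureRelations

variable {γ lgγ : ℝ → ℂ} {W WL WR : ℂ → Mat N} {AL BL AR BR : Mat N}
  {PL PR : ℕ → (Mat N)[X]} {Cn : ℕ → Mat N}

/-! ### Structure relations for the polynomials -/

/-- The first two terms match the coefficients of degree `n + 2` and `n + 1`. The last, of degree
`n`, corrects moment `n`, and all lower moments already vanish. -/
theorem pearsonOp_succ (hγ : IsLoop γ) (hlg : IsLogAlong γ lgγ) (hW : LoopIntegrable γ W)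
    (hWL : SolvesLeft (fun z => z • AL + BL) WL) (hWR : SolvesRight (fun z => z • AR + BR) WR)
    (hfac : Factorises γ lgγ W WL WR) (hP : IsBiorthogonalSystem γ W PL PR Cn) (n : ℕ) :
    pearsonOp AL BL (PL (n + 1))
      = C (AL + ((n + 1 : ℕ) : ℂ) • 1) * (X * PL (n + 1))
        + C (matComm (PL (n + 1)).nextCoeff AL - (PL (n + 1)).nextCoeff + BL) * PL (n + 1)
        - C ((AL * (Cn (n + 1))⁻¹ + (Cn (n + 1))⁻¹ * AR
            + (2 * ((n + 1 : ℕ) : ℂ) + 1) • (Cn (n + 1))⁻¹) * Cn n) * PL n := by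
  rw [← sub_eq_zero]
  refine eq_zero_of_polyMoment hγ hW hP (n := n + 1) (fun k hk => ?_) fun k hk => ?_
  · obtain ⟨j, rfl⟩ : ∃ j, k = j + 1 := ⟨k - 1, by omega⟩
    have h0 : (PL n).coeff (j + 1) = 0 := coeff_eq_zero_of_lt hP.degreeL (by omega)
    rw [coeff_sub, coeff_pearsonOp_succ, coeff_sub, coeff_add, coeff_C_mul, coeff_C_mul,
      coeff_C_mul, coeff_X_mul, h0, mul_zero, sub_zero]
    rcases eq_or_lt_of_le (show n ≤ j by omega) with rfl | hlt
    · rw [coeff_self hP.monicL hP.degreeL, ← nextCoeff_succ hP.degreeL, matComm]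
      push_cast
      simp only [add_mul, smul_mul_assoc, one_mul, mul_one]
      module
    · have h1 : (PL (n + 1)).coeff (j + 1) = 0 := coeff_eq_zero_of_lt hP.degreeL (by omega)
      rw [h1]
      rcases eq_or_lt_of_le (show n + 1 ≤ j by omega) with rfl | hlt
      · rw [coeff_self hP.monicL hP.degreeL]
        simp only [zero_mul, mul_zero, mul_one, one_mul]
        module
      · have h2 : (PL (n + 1)).coeff j = 0 := coeff_eq_zero_of_lt hP.degreeL hlt
        rw [h2]
        simp
  · rw [polyMoment_sub hγ hW, polyMoment_pearsonOp hγ hlg hW hWL hWR hfac, polyMoment_sub hγ hW,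
      polyMoment_add hγ hW, polyMoment_C_mul hγ hW, polyMoment_C_mul hγ hW,
      polyMoment_C_mul hγ hW, polyMoment_X_mul, polyMoment_left hP (by omega : k + 1 ≤ n + 1),
      polyMoment_left hP (by omega : k ≤ n + 1), polyMoment_left hP (by omega : k ≤ n),
      if_neg (by omega : ¬ n + 1 = k)]
    rcases eq_or_lt_of_le (show k ≤ n by omega) with rfl | hlt
    · rw [if_pos rfl, if_pos rfl, mul_assoc, Matrix.mul_nonsing_inv _ (hP.nonsingular k)]
      push_cast
      simp only [add_mul, smul_mul_assoc, one_mul, mul_one, zero_mul, mul_zero]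
      module
    · rw [if_neg (by omega), if_neg (by omega)]
      simp

/-- This second expansion serves the lower block row. Moment `n - 1`, when present, matches the `X *
PL n` term; moment `n` matches the `PL n` term through `polyMoment_left_succ`; the `PL (n + 1)` term
fixes the leading coefficient without affecting these moments. Conjugation by `C_n` disappears after
multiplication by `-C_n`. -/
theorem pearsonOp_eq (hγ : IsLoop γ) (hlg : IsLogAlong γ lgγ) (hW : LoopIntegrable γ W)
    (hWL : SolvesLeft (fun z => z • AL + BL) WL) (hWR : SolvesRight (fun z => z • AR + BR) WR)
    (hfac : Factorises γ lgγ W WL WR) (hP : IsBiorthogonalSystem γ W PL PR Cn) (n : ℕ) :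
    pearsonOp AL BL (PL n)
      = C (AL + (Cn n)⁻¹ * AR * Cn n + (2 * (n : ℂ) + 1) • 1) * PL (n + 1)
        - C ((Cn n)⁻¹ * (((n : ℂ) + 1) • 1 + AR) * Cn n) * (X * PL n)
        + C ((Cn n)⁻¹ * (matComm (PR (n + 1)).nextCoeff AR + (PR (n + 1)).nextCoeff - BR) * Cn n)
          * PL n := by
  have hc := Matrix.nonsing_inv_mul _ (hP.nonsingular n)
  have hc' := Matrix.mul_nonsing_inv _ (hP.nonsingular n)
  rw [← sub_eq_zero]
  refine eq_zero_of_polyMoment hγ hW hP (n := n + 1) (fun k hk => ?_) fun k hk => ?_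
  · obtain ⟨j, rfl⟩ : ∃ j, k = j + 1 := ⟨k - 1, by omega⟩
    have h0 : (PL n).coeff (j + 1) = 0 := coeff_eq_zero_of_lt hP.degreeL (by omega)
    rw [coeff_sub, coeff_pearsonOp_succ, coeff_add, coeff_sub, coeff_C_mul, coeff_C_mul,
      coeff_C_mul, coeff_X_mul, h0, mul_zero, add_zero]
    rcases eq_or_lt_of_le (show n ≤ j by omega) with rfl | hlt
    · rw [coeff_self hP.monicL hP.degreeL, coeff_self hP.monicL hP.degreeL]
      simp only [mul_add, add_mul, mul_smul_comm, smul_mul_assoc, mul_one, one_mul, zero_mul, hc]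
      module
    · have h1 : (PL (n + 1)).coeff (j + 1) = 0 := coeff_eq_zero_of_lt hP.degreeL (by omega)
      have h2 : (PL n).coeff j = 0 := coeff_eq_zero_of_lt hP.degreeL hlt
      rw [h1, h2]
      simp
  · rw [polyMoment_sub hγ hW, polyMoment_pearsonOp hγ hlg hW hWL hWR hfac, polyMoment_add hγ hW,
      polyMoment_sub hγ hW, polyMoment_C_mul hγ hW, polyMoment_C_mul hγ hW,
      polyMoment_C_mul hγ hW, polyMoment_X_mul,
      polyMoment_left hP (by omega : k ≤ n + 1), polyMoment_left hP (by omega : k ≤ n),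
      if_neg (by omega : ¬ n + 1 = k)]
    rcases eq_or_lt_of_le (show k ≤ n by omega) with rfl | hlt
    · rw [if_pos rfl, polyMoment_left_succ hγ hW hP, matComm]
      simp only [mul_assoc, mul_neg, neg_mul, mul_zero, hc', mul_one,
        ← mul_assoc (Cn k) (Cn k)⁻¹, one_mul, mul_add, mul_sub, add_mul, smul_mul_assoc,
        mul_smul_comm, sub_mul, smul_neg]
      module
    · rw [if_neg (by omega), polyMoment_left hP (by omega : k + 1 ≤ n)]
      rcases eq_or_lt_of_le (show k + 1 ≤ n by omega) with rfl | hlt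
      · rw [if_pos rfl]
        push_cast
        simp only [mul_assoc, mul_zero, hc', mul_one, zero_mul, mul_add, add_mul, smul_mul_assoc,
          mul_smul_comm]
        module
      · rw [if_neg (by omega)]
        simp

/-! ### Structure relations for the functions of the second kind -/

theorem continuousOn_sub_sq_inv {z : ℂ} (hz : z ∉ loopTrace γ) :
    ContinuousOn (fun t => ((t - z) ^ 2)⁻¹) (loopTrace γ) :=
  ((continuousOn_id.sub continuousOn_const).pow 2).inv₀ fun t ht =>
    pow_ne_zero 2 (sub_ne_zero.2 fun h => hz ((show t = z from h) ▸ ht))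

/-- Differentiation under the integral: on a ball of half the distance available around `z`, the
derivative of the Cauchy kernel is bounded uniformly along the loop, and `G` is integrable. -/
theorem hasDerivAt_loopIntegral_sub_inv (hγ : IsLoop γ) {G : ℂ → Mat N} (hG : LoopIntegrable γ G)
    {z : ℂ} (hz : z ∉ loopTrace γ) (i j : Fin N) :
    HasDerivAt (fun x => loopIntegral γ (fun t => (t - x)⁻¹ • G t) i j)
      (loopIntegral γ (fun t => ((t - z) ^ 2)⁻¹ • G t) i j) z := by
  simp only [loopIntegral, Matrix.of_apply]
  refine HasDerivAt.const_mul _ ?_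
  obtain ⟨r, hr, hball⟩ := Metric.isOpen_iff.1 (isCompact_loopTrace hγ).isClosed.isOpen_compl z hz
  have hdist : ∀ x ∈ Metric.ball z (r / 2), ∀ t ∈ loopTrace γ, r / 2 ≤ ‖t - x‖ := by
    intro x hx t ht
    by_contra! hlt
    refine hball (?_ : t ∈ Metric.ball z r) ht
    rw [Metric.mem_ball] at hx ⊢
    have := dist_triangle t x z
    rw [dist_eq_norm t x] at this
    linarith
  have hmem : ∀ x ∈ Metric.ball z (r / 2), x ∉ loopTrace γ := fun x hx hxt => by
    have := hdist x hx x hxt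
    rw [sub_self, norm_zero] at this
    linarith
  have hF : ∀ x ∈ Metric.ball z (r / 2), IntervalIntegrable
      (fun s => deriv γ s * ((γ s - x)⁻¹ • G (γ s)) i j) volume 0 1 := fun x hx =>
    (hG.smul hγ (continuousOn_sub_inv (hmem x hx))) i j
  have hzb : z ∈ Metric.ball z (r / 2) := Metric.mem_ball_self (by linarith)
  have hF' : IntervalIntegrable
      (fun s => deriv γ s * (((γ s - z) ^ 2)⁻¹ • G (γ s)) i j) volume 0 1 := by
    exact (hG.smul hγ (continuousOn_sub_sq_inv hz)) i j
  refine (intervalIntegral.hasDerivAt_integral_of_dominated_loc_of_deriv_le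
    (F := fun x s => deriv γ s * ((γ s - x)⁻¹ • G (γ s)) i j)
    (F' := fun x s => deriv γ s * (((γ s - x) ^ 2)⁻¹ • G (γ s)) i j)
    (bound := fun s => ((r / 2) ^ 2)⁻¹ * ‖deriv γ s * G (γ s) i j‖)
    (Metric.ball_mem_nhds z (by linarith : 0 < r / 2)) ?_ (hF z hzb)
    (IntervalIntegrable.def' hF').aestronglyMeasurable ?_ ((hG i j).norm.const_mul _) ?_).2
  · filter_upwards [Metric.ball_mem_nhds z (by linarith : 0 < r / 2)] with x hx
    exact (IntervalIntegrable.def' (hF x hx)).aestronglyMeasurable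
  · refine Eventually.of_forall fun s hs x hx => ?_
    rw [uIoc_of_le zero_le_one] at hs
    have h1 := hdist x hx _ (mem_loopTrace (Ioc_subset_Icc_self hs))
    rw [Matrix.smul_apply, smul_eq_mul, mul_left_comm, norm_mul, norm_inv, norm_pow]
    gcongr
  · refine Eventually.of_forall fun s hs x hx => ?_
    rw [uIoc_of_le zero_le_one] at hs
    have hne : γ s - x ≠ 0 := sub_ne_zero.2 fun h =>
      hmem x hx (h ▸ mem_loopTrace (Ioc_subset_Icc_self hs))
    simp only [Matrix.smul_apply, smul_eq_mul]
    have h1 : HasDerivAt (fun x => (γ s - x)⁻¹) (((γ s - x) ^ 2)⁻¹) x := by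
      have := ((hasDerivAt_id x).const_sub (γ s)).inv hne
      simpa [neg_div, one_div, Pi.inv_def] using this
    exact (h1.mul_const _).const_mul _

theorem hasDerivAt_secondKindL (hγ : IsLoop γ) (hW : LoopIntegrable γ W) {z : ℂ}
    (hz : z ∉ loopTrace γ) (P : (Mat N)[X]) (i j : Fin N) :
    HasDerivAt (fun x => secondKindL γ W P x i j)
      (pairing γ W (fun t => ((t - z) ^ 2)⁻¹) P 1 i j) z := by
  have := hasDerivAt_loopIntegral_sub_inv hγ
    (hW.mul_left hγ fun i j => (continuous_evalAt P i j).continuousOn) hz i j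
  simpa only [pairing, secondKindL, evalAt_one, mul_one] using this

/-- Based on `t/(t - z) = 1 + z/(t - z)`. -/
theorem pairing_sub_inv_X_mul (hγ : IsLoop γ) (hW : LoopIntegrable γ W) {z : ℂ}
    (hz : z ∉ loopTrace γ) (P : (Mat N)[X]) :
    pairing γ W (fun t => (t - z)⁻¹) (X * P) 1
      = polyMoment γ W 0 P + z • secondKindL γ W P z := by
  rw [pairing_X_mul_left, pairing_congr (ψ := fun t => t ^ 0 + z * (t - z)⁻¹) (fun t ht => ?_),
    pairing_add_fun (ψ := fun t => z * (t - z)⁻¹) hγ hW (continuousOn_pow_id 0 _)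
      (continuousOn_const.mul (continuousOn_sub_inv hz)), pairing_smul_fun, ← secondKindL_eq,
    polyMoment]
  have : t - z ≠ 0 := sub_ne_zero.2 fun h => hz (h ▸ ht)
  field_simp
  ring

/-- For `φ = 1/(t - z)` one has `2tφ + t²φ' = 1 - z²/(t - z)²`. The last kernel is that of the
derivative of the Cauchy transform, so `z² Q'` appears, with moment `0` as the only correction. -/
theorem pairing_sub_inv_pearsonOp (hγ : IsLoop γ) (hlg : IsLogAlong γ lgγ)
    (hW : LoopIntegrable γ W)
    (hWL : SolvesLeft (fun z => z • AL + BL) WL) (hWR : SolvesRight (fun z => z • AR + BR) WR)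
    (hfac : Factorises γ lgγ W WL WR) {z : ℂ} (hz : z ∉ loopTrace γ) (P : (Mat N)[X]) :
    pairing γ W (fun t => (t - z)⁻¹) (pearsonOp AL BL P) 1
      = z ^ 2 • pairing γ W (fun t => ((t - z) ^ 2)⁻¹) P 1
        - secondKindL γ W P z * (z • AR + BR)
        - polyMoment γ W 0 P - polyMoment γ W 0 P * AR := by
  have hne : ∀ t ∈ loopTrace γ, t - z ≠ 0 := fun t ht => sub_ne_zero.2 fun h => hz (h ▸ ht)
  have hsq : ContinuousOn (fun t => ((t - z) ^ 2)⁻¹) (loopTrace γ) :=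
    continuousOn_sub_sq_inv hz
  have h := pairing_pearsonOp hγ hlg hW hWL hWR hfac (φ := fun t => (t - z)⁻¹)
    (φ' := fun t => -((t - z) ^ 2)⁻¹) (fun t ht => by
      have := ((hasDerivAt_id t).sub_const z).inv (hne t ht)
      simpa [neg_div, one_div, Pi.inv_def] using this) hsq.neg P
  have h2 := pairing_sub_inv_X_mul hγ hW hz P
  rw [pairing_X_mul_left] at h2
  rw [h, h2, ← secondKindL_eq,
    pairing_congr (ψ := fun t => t ^ 0 + -z ^ 2 * ((t - z) ^ 2)⁻¹) (fun t ht => ?_),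
    pairing_add_fun (ψ := fun t => -z ^ 2 * ((t - z) ^ 2)⁻¹) hγ hW (continuousOn_pow_id 0 _)
      (continuousOn_const.mul hsq),
    pairing_smul_fun, ← polyMoment]
  · simp only [add_mul, mul_add, smul_mul_assoc, mul_smul_comm]
    module
  · have := hne t ht
    field_simp
    ring

theorem polyMoment_zero_succ (hP : IsBiorthogonalSystem γ W PL PR Cn) (n : ℕ) :
    polyMoment γ W 0 (PL (n + 1)) = 0 := by
  rw [polyMoment_left hP (Nat.zero_le _), if_neg (Nat.succ_ne_zero n)]

/-- The Cauchy transform of `pearsonOp_succ`; the corrections vanish because moment `0` of `PL (n +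
1)` does. -/
theorem secondKindL_succ_relation (hγ : IsLoop γ) (hlg : IsLogAlong γ lgγ)
    (hW : LoopIntegrable γ W)
    (hWL : SolvesLeft (fun z => z • AL + BL) WL) (hWR : SolvesRight (fun z => z • AR + BR) WR)
    (hfac : Factorises γ lgγ W WL WR) (hP : IsBiorthogonalSystem γ W PL PR Cn)
    {z : ℂ} (hz : z ∉ loopTrace γ) (n : ℕ) :
    z ^ 2 • pairing γ W (fun t => ((t - z) ^ 2)⁻¹) (PL (n + 1)) 1
        - secondKindL γ W (PL (n + 1)) z * (z • AR + BR)
      = (z • (AL + ((n + 1 : ℕ) : ℂ) • 1)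
          + matComm (PL (n + 1)).nextCoeff AL - (PL (n + 1)).nextCoeff + BL)
          * secondKindL γ W (PL (n + 1)) z
        - (AL * (Cn (n + 1))⁻¹ + (Cn (n + 1))⁻¹ * AR
            + (2 * ((n + 1 : ℕ) : ℂ) + 1) • (Cn (n + 1))⁻¹) * Cn n
          * secondKindL γ W (PL n) z := by
  have hc := continuousOn_sub_inv hz
  have h := pairing_sub_inv_pearsonOp hγ hlg hW hWL hWR hfac hz (PL (n + 1))
  rw [pearsonOp_succ hγ hlg hW hWL hWR hfac hP, pairing_sub_left hγ hW hc,
    pairing_add_left hγ hW hc, pairing_C_mul hγ hW hc, pairing_C_mul hγ hW hc,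
    pairing_C_mul hγ hW hc, pairing_sub_inv_X_mul hγ hW hz, ← secondKindL_eq, ← secondKindL_eq,
    polyMoment_zero_succ hP, zero_mul, sub_zero, sub_zero, zero_add] at h
  rw [← h]
  simp only [add_mul, sub_mul, smul_mul_assoc, mul_smul_comm]
  module

theorem secondKindL_relation (hγ : IsLoop γ) (hlg : IsLogAlong γ lgγ)
    (hW : LoopIntegrable γ W)
    (hWL : SolvesLeft (fun z => z • AL + BL) WL) (hWR : SolvesRight (fun z => z • AR + BR) WR)
    (hfac : Factorises γ lgγ W WL WR) (hP : IsBiorthogonalSystem γ W PL PR Cn)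
    {z : ℂ} (hz : z ∉ loopTrace γ) (n : ℕ) :
    z ^ 2 • pairing γ W (fun t => ((t - z) ^ 2)⁻¹) (PL n) 1
        - secondKindL γ W (PL n) z * (z • AR + BR)
      = (AL + (Cn n)⁻¹ * AR * Cn n + (2 * (n : ℂ) + 1) • 1) * secondKindL γ W (PL (n + 1)) z
        + (Cn n)⁻¹ * (-(z • (((n : ℂ) + 1) • 1 + AR))
          + matComm (PR (n + 1)).nextCoeff AR + (PR (n + 1)).nextCoeff - BR) * Cn n
          * secondKindL γ W (PL n) z := by
  have hc := continuousOn_sub_inv hz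
  have h := pairing_sub_inv_pearsonOp hγ hlg hW hWL hWR hfac hz (PL n)
  rw [pearsonOp_eq hγ hlg hW hWL hWR hfac hP, pairing_add_left hγ hW hc,
    pairing_sub_left hγ hW hc, pairing_C_mul hγ hW hc, pairing_C_mul hγ hW hc,
    pairing_C_mul hγ hW hc, pairing_sub_inv_X_mul hγ hW hz, ← secondKindL_eq, ← secondKindL_eq] at h
  -- The moment corrections on the two sides cancel: for `n = 0` because the moment is `C_0⁻¹`, and
  -- for larger `n` because it is zero.
  have h0 : (Cn n)⁻¹ * (((n : ℂ) + 1) • 1 + AR) * Cn n * polyMoment γ W 0 (PL n)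
      = polyMoment γ W 0 (PL n) + polyMoment γ W 0 (PL n) * AR := by
    rcases n with _ | n
    · rw [polyMoment_left hP le_rfl, if_pos rfl, mul_assoc,
        Matrix.mul_nonsing_inv _ (hP.nonsingular 0), mul_one, mul_add]
      simp
    · rw [polyMoment_zero_succ hP]
      simp
  rw [mul_add, h0, sub_sub (_ - _) (polyMoment γ W 0 (PL n)), eq_sub_iff_add_eq] at h
  rw [← h]
  simp only [add_mul, sub_mul, mul_add, mul_sub, mul_neg, neg_mul, smul_mul_assoc, mul_smul_comm]
  module

/-- At index `0` the moment `C_0⁻¹` survives. Its inhomogeneous term is the upper right block acting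
on the identity in the lower right corner of `Y_0`. -/
theorem secondKindL_zero_relation (hγ : IsLoop γ) (hlg : IsLogAlong γ lgγ)
    (hW : LoopIntegrable γ W)
    (hWL : SolvesLeft (fun z => z • AL + BL) WL) (hWR : SolvesRight (fun z => z • AR + BR) WR)
    (hfac : Factorises γ lgγ W WL WR) (hP : IsBiorthogonalSystem γ W PL PR Cn)
    {z : ℂ} (hz : z ∉ loopTrace γ) :
    z ^ 2 • pairing γ W (fun t => ((t - z) ^ 2)⁻¹) (PL 0) 1
        - secondKindL γ W (PL 0) z * (z • AR + BR)
      = (z • AL + BL) * secondKindL γ W (PL 0) z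
        + (AL * (Cn 0)⁻¹ + (Cn 0)⁻¹ * AR + (Cn 0)⁻¹) := by
  have hc := continuousOn_sub_inv hz
  have h := pairing_sub_inv_pearsonOp hγ hlg hW hWL hWR hfac hz (PL 0)
  have hT : pearsonOp AL BL (PL 0) = C AL * (X * PL 0) + C BL * PL 0 := by
    rw [eq_one_of_index_zero hP.monicL hP.degreeL, pearsonOp]
    simp [X_mul_C]
  rw [hT, pairing_add_left hγ hW hc, pairing_C_mul hγ hW hc, pairing_C_mul hγ hW hc,
    pairing_sub_inv_X_mul hγ hW hz, ← secondKindL_eq, polyMoment_left hP le_rfl, if_pos rfl,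
    sub_sub (_ - _) (Cn 0)⁻¹, eq_sub_iff_add_eq] at h
  rw [← h]
  simp only [add_mul, mul_add, smul_mul_assoc, mul_smul_comm]
  abel

/-! ### Christoffel–Darboux type identities -/

/-- Both products equal the integral of `P^L W P^R/(t - z)` up to pairings with quotients of degree
below `n`, which biorthogonality kills. -/
theorem mul_secondKindR_eq (hγ : IsLoop γ) (hW : LoopIntegrable γ W)
    (hP : IsBiorthogonalSystem γ W PL PR Cn) {z : ℂ} (hz : z ∉ loopTrace γ) (n : ℕ) :
    evalAt (PL n) z * secondKindR γ W (PR n) z = secondKindL γ W (PL n) z * evalAt (PR n) z := by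
  obtain ⟨Q, hQ, h1⟩ := exists_mul_secondKindR hγ hW hz (PL n) (PR n)
  obtain ⟨R, hR, h2⟩ := exists_secondKindL_mul hγ hW hz (PL n) (PR n)
  have hQ' : ∀ k, n ≤ k → Q.coeff k = 0 := fun k hk => by
    rw [hQ k (by rw [hP.degreeL]; omega), coeff_eq_zero_of_lt hP.degreeL (by omega)]
  have hR' : ∀ k, n ≤ k → R.coeff k = 0 := fun k hk => by
    rw [hR k (by rw [hP.degreeR]; omega), coeff_eq_zero_of_lt hP.degreeR (by omega)]
  rw [h1, h2, pairing_right hγ hW hP (natDegree_le_iff_coeff_eq_zero.2 fun k hk => hQ' k hk.le),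
    pairing_left hγ hW hP (natDegree_le_iff_coeff_eq_zero.2 fun k hk => hR' k hk.le),
    hQ' n le_rfl, hR' n le_rfl, zero_mul, mul_zero]

/-- With the left degree raised by one, its quotient has degree `n` and leading coefficient `1`, so
its pairing with `PR n` leaves exactly `C_n⁻¹`. -/
theorem secondKindL_succ_mul (hγ : IsLoop γ) (hW : LoopIntegrable γ W)
    (hP : IsBiorthogonalSystem γ W PL PR Cn) {z : ℂ} (hz : z ∉ loopTrace γ) (n : ℕ) :
    secondKindL γ W (PL (n + 1)) z * evalAt (PR n) z
      - evalAt (PL (n + 1)) z * secondKindR γ W (PR n) z = (Cn n)⁻¹ := by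
  obtain ⟨Q, hQ, h1⟩ := exists_mul_secondKindR hγ hW hz (PL (n + 1)) (PR n)
  obtain ⟨R, hR, h2⟩ := exists_secondKindL_mul hγ hW hz (PL (n + 1)) (PR n)
  have hQ' : ∀ k, n ≤ k → Q.coeff k = (PL (n + 1)).coeff (k + 1) := fun k hk =>
    hQ k (by rw [hP.degreeL]; omega)
  have hR' : ∀ k, n ≤ k → R.coeff k = 0 := fun k hk => by
    rw [hR k (by rw [hP.degreeR]; omega), coeff_eq_zero_of_lt hP.degreeR (by omega)]
  rw [h1, h2, pairing_right hγ hW hP (natDegree_le_iff_coeff_eq_zero.2 fun k hk => by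
      rw [hQ' k hk.le, coeff_eq_zero_of_lt hP.degreeL (by omega)]),
    pairing_left hγ hW hP (n := n + 1)
      (natDegree_le_iff_coeff_eq_zero.2 fun k hk => hR' k (by omega)),
    hQ' n le_rfl, hR' (n + 1) (by omega), coeff_self hP.monicL hP.degreeL, mul_zero, one_mul]
  abel

theorem mul_secondKindR_succ (hγ : IsLoop γ) (hW : LoopIntegrable γ W)
    (hP : IsBiorthogonalSystem γ W PL PR Cn) {z : ℂ} (hz : z ∉ loopTrace γ) (n : ℕ) :
    evalAt (PL n) z * secondKindR γ W (PR (n + 1)) z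
      - secondKindL γ W (PL n) z * evalAt (PR (n + 1)) z = (Cn n)⁻¹ := by
  obtain ⟨Q, hQ, h1⟩ := exists_mul_secondKindR hγ hW hz (PL n) (PR (n + 1))
  obtain ⟨R, hR, h2⟩ := exists_secondKindL_mul hγ hW hz (PL n) (PR (n + 1))
  have hR' : ∀ k, n ≤ k → R.coeff k = (PR (n + 1)).coeff (k + 1) := fun k hk =>
    hR k (by rw [hP.degreeR]; omega)
  have hQ' : ∀ k, n ≤ k → Q.coeff k = 0 := fun k hk => by
    rw [hQ k (by rw [hP.degreeL]; omega), coeff_eq_zero_of_lt hP.degreeL (by omega)]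
  rw [h1, h2, pairing_left hγ hW hP (natDegree_le_iff_coeff_eq_zero.2 fun k hk => by
      rw [hR' k hk.le, coeff_eq_zero_of_lt hP.degreeR (by omega)]),
    pairing_right hγ hW hP (n := n + 1)
      (natDegree_le_iff_coeff_eq_zero.2 fun k hk => hQ' k (by omega)),
    hR' n le_rfl, hQ' (n + 1) (by omega), coeff_self hP.monicR hP.degreeR, zero_mul, mul_one]
  abel

end structureRelations

/-! ### Entrywise calculus of matrix functions -/

section calculus

variable {ι : Type}

theorem matDeriv_eq {F : ℂ → Matrix ι ι ℂ} {F' : Matrix ι ι ℂ} {z : ℂ}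
    (h : ∀ i j, HasDerivAt (fun x => F x i j) (F' i j) z) : matDeriv F z = F' := by
  ext i j
  exact (h i j).deriv

theorem hasDerivAt_matDeriv_of_analyticAt {F : ℂ → Matrix ι ι ℂ} {z : ℂ}
    (hF : ∀ i j, AnalyticAt ℂ (fun x => F x i j) z) (i j : ι) :
    HasDerivAt (fun x => F x i j) (matDeriv F z i j) z :=
  (hF i j).differentiableAt.hasDerivAt

theorem matDeriv_const (M : Matrix ι ι ℂ) (z : ℂ) : matDeriv (fun _ => M) z = 0 :=
  matDeriv_eq fun _ _ => hasDerivAt_const _ _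

variable [Fintype ι]

theorem analyticAt_mul_apply {F G : ℂ → Matrix ι ι ℂ} {z : ℂ}
    (hF : ∀ i j, AnalyticAt ℂ (fun x => F x i j) z)
    (hG : ∀ i j, AnalyticAt ℂ (fun x => G x i j) z) (i j : ι) :
    AnalyticAt ℂ (fun x => (F x * G x) i j) z := by
  simp only [Matrix.mul_apply]
  exact Finset.analyticAt_fun_sum _ fun l _ => (hF i l).mul (hG l j)

theorem matDeriv_mul {F G : ℂ → Matrix ι ι ℂ} {z : ℂ}
    (hF : ∀ i j, AnalyticAt ℂ (fun x => F x i j) z)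
    (hG : ∀ i j, AnalyticAt ℂ (fun x => G x i j) z) :
    matDeriv (fun x => F x * G x) z = matDeriv F z * G z + F z * matDeriv G z :=
  matDeriv_eq (hasDerivAt_mul_apply (fun i j => hasDerivAt_matDeriv_of_analyticAt hF i j)
      (fun i j => hasDerivAt_matDeriv_of_analyticAt hG i j))

variable [DecidableEq ι]

theorem analyticAt_det {F : ℂ → Matrix ι ι ℂ} {z : ℂ}
    (hF : ∀ i j, AnalyticAt ℂ (fun x => F x i j) z) : AnalyticAt ℂ (fun x => (F x).det) z := by
  simp only [Matrix.det_apply']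
  exact Finset.analyticAt_fun_sum _ fun σ _ =>
    analyticAt_const.mul (Finset.analyticAt_fun_prod _ fun i _ => hF _ _)

theorem analyticAt_inv_apply {F : ℂ → Matrix ι ι ℂ} {z : ℂ}
    (hF : ∀ i j, AnalyticAt ℂ (fun x => F x i j) z) (hz : IsUnit (F z).det) (i j : ι) :
    AnalyticAt ℂ (fun x => (F x)⁻¹ i j) z := by
  simp only [Matrix.inv_def, Ring.inverse_eq_inv', Matrix.smul_apply, smul_eq_mul,
    Matrix.adjugate_apply]
  refine ((analyticAt_det hF).inv hz.ne_zero).mul (analyticAt_det fun k l => ?_)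
  -- An adjugate entry is the determinant of `F` with one row replaced by a constant one.
  by_cases h : k = j
  · subst h
    simp only [Matrix.updateRow_self]
    exact analyticAt_const
  · simp only [Matrix.updateRow_ne h]
    exact hF k l

/-- The derivative of a right inverse. -/
theorem matDeriv_of_mul_eq_one {F G : ℂ → Matrix ι ι ℂ} {z : ℂ}
    (hF : ∀ i j, AnalyticAt ℂ (fun x => F x i j) z)
    (hG : ∀ i j, AnalyticAt ℂ (fun x => G x i j) z) (h : ∀ᶠ x in 𝓝 z, F x * G x = 1) :
    matDeriv G z = -(G z * matDeriv F z * G z) := by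
  have h1 : matDeriv F z * G z + F z * matDeriv G z = 0 := by
    ext i j
    have h2 := hasDerivAt_mul_apply (fun i j => hasDerivAt_matDeriv_of_analyticAt hF i j)
      (fun i j => hasDerivAt_matDeriv_of_analyticAt hG i j) i j
    have h3 : HasDerivAt (fun x => (F x * G x) i j) 0 z :=
      (hasDerivAt_const z ((1 : Matrix ι ι ℂ) i j)).congr_of_eventuallyEq
        (h.mono fun x hx => congrFun (congrFun hx i) j)
    exact h2.unique h3
  have hGF : G z * F z = 1 := mul_eq_one_comm.1 h.self_of_nhds
  have h4 := congrArg (G z * ·) h1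
  simp only [mul_add, ← mul_assoc, hGF, one_mul, mul_zero] at h4
  exact eq_neg_of_add_eq_zero_right h4

end calculus

theorem analyticAt_fromBlocks {A B C D : ℂ → Mat N} {z : ℂ}
    (hA : ∀ i j, AnalyticAt ℂ (fun x => A x i j) z)
    (hB : ∀ i j, AnalyticAt ℂ (fun x => B x i j) z)
    (hC : ∀ i j, AnalyticAt ℂ (fun x => C x i j) z)
    (hD : ∀ i j, AnalyticAt ℂ (fun x => D x i j) z) (i j : Fin N ⊕ Fin N) :
    AnalyticAt ℂ (fun x => Matrix.fromBlocks (A x) (B x) (C x) (D x) i j) z := by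
  rcases i with i | i <;> rcases j with j | j
  · exact hA i j
  · exact hB i j
  · exact hC i j
  · exact hD i j

theorem matDeriv_fromBlocks {A B C D : ℂ → Mat N} {z : ℂ} :
    matDeriv (fun x => Matrix.fromBlocks (A x) (B x) (C x) (D x)) z
      = Matrix.fromBlocks (matDeriv A z) (matDeriv B z) (matDeriv C z) (matDeriv D z) := by
  ext i j
  rcases i with i | i <;> rcases j with j | j <;> rfl

/-! ### Branches of the factors of the weight -/

theorem IsLogBranchAt.hasDerivAt {lg : ℂ → ℂ} {z : ℂ} (h : IsLogBranchAt lg z) :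
    HasDerivAt lg z⁻¹ z := by
  have h1 := h.1.differentiableAt.hasDerivAt
  have h2 : HasDerivAt (fun x => Complex.exp (lg x)) (Complex.exp (lg z) * deriv lg z) z := h1.cexp
  have h3 : HasDerivAt (fun x => Complex.exp (lg x)) 1 z :=
    (hasDerivAt_id z).congr_of_eventuallyEq h.2
  have h4 := h2.unique h3
  rw [h.2.self_of_nhds] at h4
  rwa [eq_inv_of_mul_eq_one_right h4] at h1

/-- Under `w = log z` one has `d/dz = z⁻¹ d/dw`, which converts the equations in `w` back to those
in `z`. -/
theorem sq_smul_matDeriv_comp {lg : ℂ → ℂ} {z : ℂ} (h : IsLogBranchAt lg z) (hz : z ≠ 0)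
    {F : ℂ → Mat N} (hF : ∀ i j, Differentiable ℂ fun w => F w i j) :
    z ^ 2 • matDeriv (fun x => F (lg x)) z = Complex.exp (lg z) • matDeriv F (lg z) := by
  have h1 : matDeriv (fun x => F (lg x)) z = z⁻¹ • matDeriv F (lg z) := by
    refine matDeriv_eq fun i j => ?_
    have h2 := (hasDerivAt_matDeriv hF (lg z) i j).comp z h.hasDerivAt
    rw [mul_comm] at h2
    exact h2
  rw [h1, h.2.self_of_nhds, smul_smul]
  congr 1
  field_simp

theorem analyticAt_comp_branch {lg : ℂ → ℂ} {z : ℂ} (h : IsLogBranchAt lg z)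
    {F : ℂ → Mat N} (hF : ∀ i j, Differentiable ℂ fun w => F w i j) (i j : Fin N) :
    AnalyticAt ℂ (fun x => F (lg x) i j) z :=
  ((hF i j).analyticAt (lg z)).comp h.1

theorem matDeriv_left_branch {lg : ℂ → ℂ} {z : ℂ} (h : IsLogBranchAt lg z) (hz : z ≠ 0)
    {hL WL : ℂ → Mat N} (hWL : SolvesLeft hL WL) :
    z ^ 2 • matDeriv (fun x => WL (lg x)) z = hL z * WL (lg z) := by
  rw [sq_smul_matDeriv_comp h hz hWL.holomorphic, hWL.equation, h.2.self_of_nhds]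

theorem matDeriv_right_branch_inv {lg : ℂ → ℂ} {z : ℂ} (h : IsLogBranchAt lg z) (hz : z ≠ 0)
    {hR WR : ℂ → Mat N} (hWR : SolvesRight hR WR) :
    z ^ 2 • matDeriv (fun x => (WR (lg x))⁻¹) z = -(hR z * (WR (lg z))⁻¹) := by
  have hA := analyticAt_comp_branch h hWR.holomorphic
  rw [matDeriv_of_mul_eq_one hA (analyticAt_inv_apply hA (hWR.nonsingular _))
    (Eventually.of_forall fun x => Matrix.mul_nonsing_inv _ (hWR.nonsingular _)), smul_neg,
    ← smul_mul_assoc, ← mul_smul_comm, sq_smul_matDeriv_comp h hz hWR.holomorphic, hWR.equation,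
    h.2.self_of_nhds, ← mul_assoc, Matrix.nonsing_inv_mul _ (hWR.nonsingular _), one_mul]

section blocks

variable {γ lgγ : ℝ → ℂ} {W WL WR : ℂ → Mat N} {AL BL AR BR : Mat N}
  {PL PR : ℕ → (Mat N)[X]} {Cn : ℕ → Mat N}

/-! ### The matrices `Y` -/

theorem compl_loopTrace_mem_nhds (hγ : IsLoop γ) {z : ℂ} (hz : z ∉ loopTrace γ) :
    (loopTrace γ)ᶜ ∈ 𝓝 z :=
  (isCompact_loopTrace hγ).isClosed.isOpen_compl.mem_nhds hz

theorem analyticAt_evalAt (P : (Mat N)[X]) (z : ℂ) (i j : Fin N) :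
    AnalyticAt ℂ (fun x => evalAt P x i j) z :=
  Differentiable.analyticAt (fun y => (hasDerivAt_evalAt P y i j).differentiableAt) z

theorem analyticAt_loopIntegral_sub_inv (hγ : IsLoop γ) {G : ℂ → Mat N}
    (hG : LoopIntegrable γ G) {z : ℂ} (hz : z ∉ loopTrace γ) (i j : Fin N) :
    AnalyticAt ℂ (fun x => loopIntegral γ (fun t => (t - x)⁻¹ • G t) i j) z :=
  DifferentiableOn.analyticAt (fun _ hx =>
    (hasDerivAt_loopIntegral_sub_inv hγ hG hx i j).differentiableAt.differentiableWithinAt)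
    (compl_loopTrace_mem_nhds hγ hz)

theorem analyticAt_secondKindL (hγ : IsLoop γ) (hW : LoopIntegrable γ W) {z : ℂ}
    (hz : z ∉ loopTrace γ) (P : (Mat N)[X]) (i j : Fin N) :
    AnalyticAt ℂ (fun x => secondKindL γ W P x i j) z :=
  analyticAt_loopIntegral_sub_inv hγ
    (hW.mul_left hγ fun i j => (continuous_evalAt P i j).continuousOn) hz i j

theorem analyticAt_secondKindR (hγ : IsLoop γ) (hW : LoopIntegrable γ W) {z : ℂ}
    (hz : z ∉ loopTrace γ) (P : (Mat N)[X]) (i j : Fin N) :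
    AnalyticAt ℂ (fun x => secondKindR γ W P x i j) z :=
  analyticAt_loopIntegral_sub_inv hγ
    (hW.mul_right hγ fun i j => (continuous_evalAt P i j).continuousOn) hz i j

theorem analyticAt_neg_const_mul {F : ℂ → Mat N} {z : ℂ} (c : Mat N)
    (hF : ∀ i j, AnalyticAt ℂ (fun x => F x i j) z) (i j : Fin N) :
    AnalyticAt ℂ (fun x => (-(c * F x)) i j) z :=
  (analyticAt_mul_apply (F := fun _ => c) (fun _ _ => analyticAt_const) hF i j).neg

theorem analyticAt_neg_mul_const {F : ℂ → Mat N} {z : ℂ} (c : Mat N)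
    (hF : ∀ i j, AnalyticAt ℂ (fun x => F x i j) z) (i j : Fin N) :
    AnalyticAt ℂ (fun x => (-(F x * c)) i j) z :=
  (analyticAt_mul_apply (G := fun _ => c) hF (fun _ _ => analyticAt_const) i j).neg

theorem analyticAt_YL (hγ : IsLoop γ) (hW : LoopIntegrable γ W) {z : ℂ}
    (hz : z ∉ loopTrace γ) (n : ℕ) (i j : Fin N ⊕ Fin N) :
    AnalyticAt ℂ (fun x => YL γ W PL Cn n x i j) z := by
  rcases n with _ | n
  · exact analyticAt_fromBlocks (C := fun _ => 0) (D := fun _ => 1) (analyticAt_evalAt _ z)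
      (analyticAt_secondKindL hγ hW hz _) (fun _ _ => analyticAt_const)
      (fun _ _ => analyticAt_const) i j
  · exact analyticAt_fromBlocks (analyticAt_evalAt _ z)
      (analyticAt_secondKindL hγ hW hz _) (analyticAt_neg_const_mul _ (analyticAt_evalAt _ z))
      (analyticAt_neg_const_mul _ (analyticAt_secondKindL hγ hW hz _)) i j

theorem analyticAt_YR (hγ : IsLoop γ) (hW : LoopIntegrable γ W) {z : ℂ}
    (hz : z ∉ loopTrace γ) (n : ℕ) (i j : Fin N ⊕ Fin N) :
    AnalyticAt ℂ (fun x => YR γ W PR Cn n x i j) z := by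
  rcases n with _ | n
  · exact analyticAt_fromBlocks (B := fun _ => 0) (D := fun _ => 1) (analyticAt_evalAt _ z)
      (fun _ _ => analyticAt_const) (analyticAt_secondKindR hγ hW hz _)
      (fun _ _ => analyticAt_const) i j
  · exact analyticAt_fromBlocks (analyticAt_evalAt _ z)
      (analyticAt_neg_mul_const _ (analyticAt_evalAt _ z)) (analyticAt_secondKindR hγ hW hz _)
      (analyticAt_neg_mul_const _ (analyticAt_secondKindR hγ hW hz _)) i j

/-- The symplectic unit. -/
def sympl (N : ℕ) : BlockMat N := Matrix.fromBlocks 0 1 (-1) 0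

/-- The inverse of the symplectic unit. -/
def symplInv (N : ℕ) : BlockMat N := Matrix.fromBlocks 0 (-1) 1 0

theorem sympl_mul_symplInv : sympl N * symplInv N = 1 := by
  simp [sympl, symplInv, Matrix.fromBlocks_multiply]

theorem symplInv_mul_sympl : symplInv N * sympl N = 1 := by
  simp [sympl, symplInv, Matrix.fromBlocks_multiply]

theorem sympl_conj (a b c d : Mat N) :
    sympl N * Matrix.fromBlocks a b c d * symplInv N = Matrix.fromBlocks d (-c) (-b) a := by
  simp [sympl, symplInv, Matrix.fromBlocks_multiply]

theorem symplInv_conj (a b c d : Mat N) :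
    symplInv N * Matrix.fromBlocks a b c d * sympl N = Matrix.fromBlocks d (-c) (-b) a := by
  simp [sympl, symplInv, Matrix.fromBlocks_multiply]

/-- For positive index the four blocks of the product are the four Christoffel–Darboux identities.
The explicit inverse avoids any computation of `det Y`. -/
theorem YL_mul_conj_YR (hγ : IsLoop γ) (hW : LoopIntegrable γ W)
    (hP : IsBiorthogonalSystem γ W PL PR Cn) {z : ℂ} (hz : z ∉ loopTrace γ) (n : ℕ) :
    YL γ W PL Cn n z * (sympl N * YR γ W PR Cn n z * symplInv N) = 1 := by
  rcases n with _ | n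
  · have h := mul_secondKindR_eq hγ hW hP hz 0
    rw [eq_one_of_index_zero hP.monicL hP.degreeL, eq_one_of_index_zero hP.monicR hP.degreeR,
      evalAt_one, one_mul, mul_one] at h
    rw [YL, YR, sympl_conj, Matrix.fromBlocks_multiply, ← Matrix.fromBlocks_one,
      eq_one_of_index_zero hP.monicL hP.degreeL, eq_one_of_index_zero hP.monicR hP.degreeR, h]
    simp [evalAt_one]
  · have h1 := mul_secondKindR_eq hγ hW hP hz (n + 1)
    have h2 := mul_secondKindR_eq hγ hW hP hz n
    have h3 := secondKindL_succ_mul hγ hW hP hz n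
    have h4 := mul_secondKindR_succ hγ hW hP hz n
    have hc := Matrix.nonsing_inv_mul _ (hP.nonsingular n)
    have hc' := Matrix.mul_nonsing_inv _ (hP.nonsingular n)
    rw [YL, YR, sympl_conj, Matrix.fromBlocks_multiply, ← Matrix.fromBlocks_one]
    congr 1
    · rw [← hc, ← h3]
      noncomm_ring
    · rw [mul_neg, h1, neg_add_cancel]
    · simp only [mul_neg, neg_mul, neg_neg, mul_assoc]
      rw [← mul_assoc (evalAt _ _), h2, mul_assoc, add_neg_cancel]
    · rw [← hc', ← h4]
      noncomm_ring

/-- The first block column collects the polynomial relations, the second their Cauchy transforms.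
The upper row comes from the expansion with `P_{n-1}`, the lower from the one with `P_{n+1}` shifted
down by one index. -/
theorem YL_relation (hγ : IsLoop γ) (hlg : IsLogAlong γ lgγ) (hW : LoopIntegrable γ W)
    (hWL : SolvesLeft (fun z => z • AL + BL) WL) (hWR : SolvesRight (fun z => z • AR + BR) WR)
    (hfac : Factorises γ lgγ W WL WR) (hP : IsBiorthogonalSystem γ W PL PR Cn)
    {z : ℂ} (hz : z ∉ loopTrace γ) (n : ℕ) :
    z ^ 2 • matDeriv (YL γ W PL Cn n) z
        + YL γ W PL Cn n z * Matrix.fromBlocks (z • AL + BL) 0 0 (-(z • AR + BR))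
      = Matrix.fromBlocks
          (z • (AL + (n : ℂ) • (1 : Mat N))
            + matComm (PL n).nextCoeff AL - (PL n).nextCoeff + BL)
          (AL * (Cn n)⁻¹ + (Cn n)⁻¹ * AR + (2 * (n : ℂ) + 1) • (Cn n)⁻¹)
          (-(prevC Cn n * AL) - AR * prevC Cn n - (2 * (n : ℂ) - 1) • prevC Cn n)
          (-(z • ((n : ℂ) • (1 : Mat N) + AR))
            + matComm (PR n).nextCoeff AR + (PR n).nextCoeff - BR)
        * YL γ W PL Cn n z := by
  have hdP : ∀ P : (Mat N)[X], matDeriv (evalAt P) z = evalAt (derivative P) z := fun P =>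
    matDeriv_eq (hasDerivAt_evalAt P z)
  have hdQ : ∀ P : (Mat N)[X], matDeriv (secondKindL γ W P) z
      = pairing γ W (fun t => ((t - z) ^ 2)⁻¹) P 1 := fun P =>
    matDeriv_eq (hasDerivAt_secondKindL hγ hW hz P)
  rcases n with _ | n
  · have hd : matDeriv (YL γ W PL Cn 0) z = Matrix.fromBlocks (matDeriv (evalAt (PL 0)) z)
        (matDeriv (secondKindL γ W (PL 0)) z) 0 0 := by
      have := matDeriv_fromBlocks (A := evalAt (PL 0)) (B := secondKindL γ W (PL 0))
        (C := fun _ => 0) (D := fun _ => 1) (z := z)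
      rw [matDeriv_const, matDeriv_const] at this
      exact this
    have h := secondKindL_zero_relation hγ hlg hW hWL hWR hfac hP hz
    rw [sub_eq_iff_eq_add] at h
    rw [hd, hdP, hdQ, YL, Matrix.fromBlocks_smul, Matrix.fromBlocks_multiply,
      Matrix.fromBlocks_multiply, Matrix.fromBlocks_add]
    rw [h, eq_one_of_index_zero hP.monicL hP.degreeL, eq_one_of_index_zero hP.monicR hP.degreeR]
    have hn : (1 : (Mat N)[X]).nextCoeff = 0 := by
      rw [← C_1, nextCoeff_C_eq_zero]
    simp only [hn, prevC, matComm, derivative_one, mul_neg]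
    generalize secondKindL γ W 1 z * (z • AR + BR) = M
    simp [evalAt]
    abel
  · have hdC : ∀ F : ℂ → Mat N, (∀ i j, AnalyticAt ℂ (fun x => F x i j) z) →
        matDeriv (fun x => -(Cn n * F x)) z = -(Cn n * matDeriv F z) := by
      intro F hF
      have := matDeriv_mul (F := fun _ => -Cn n) (fun _ _ => analyticAt_const) hF
      simpa only [matDeriv_const, zero_mul, zero_add, neg_mul] using this
    have hd : matDeriv (YL γ W PL Cn (n + 1)) z
        = Matrix.fromBlocks (evalAt (derivative (PL (n + 1))) z)
          (pairing γ W (fun t => ((t - z) ^ 2)⁻¹) (PL (n + 1)) 1)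
          (-(Cn n * evalAt (derivative (PL n)) z))
          (-(Cn n * pairing γ W (fun t => ((t - z) ^ 2)⁻¹) (PL n) 1)) := by
      have := matDeriv_fromBlocks (A := evalAt (PL (n + 1)))
        (B := secondKindL γ W (PL (n + 1)))
        (C := fun x => -(Cn n * evalAt (PL n) x))
        (D := fun x => -(Cn n * secondKindL γ W (PL n) x)) (z := z)
      rw [hdC _ (analyticAt_evalAt _ z), hdC _ (analyticAt_secondKindL hγ hW hz _),
        hdP, hdP, hdQ, hdQ] at this
      exact this
    have h1 := congrArg (fun P => evalAt P z) (pearsonOp_succ hγ hlg hW hWL hWR hfac hP n)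
    have h2 := secondKindL_succ_relation hγ hlg hW hWL hWR hfac hP hz n
    have h3 := congrArg (fun P => evalAt P z) (pearsonOp_eq hγ hlg hW hWL hWR hfac hP n)
    have h4 := secondKindL_relation hγ hlg hW hWL hWR hfac hP hz n
    have hc' := Matrix.mul_nonsing_inv _ (hP.nonsingular n)
    -- This cancels the conjugation by `C_n` in the lower row.
    have hcc : ∀ M, Cn n * ((Cn n)⁻¹ * M) = M := fun M => by rw [← mul_assoc, hc', one_mul]
    simp only [evalAt_pearsonOp, evalAt_add, evalAt_sub, evalAt_mul, evalAt_C, evalAt_X,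
      smul_mul_assoc, one_mul] at h1 h3
    rw [hd, YL, Matrix.fromBlocks_smul, Matrix.fromBlocks_multiply,
      Matrix.fromBlocks_multiply, Matrix.fromBlocks_add]
    generalize evalAt (PL (n + 1)) z = p1 at *
    generalize evalAt (PL n) z = p at *
    generalize evalAt (derivative (PL (n + 1))) z = p1' at *
    generalize evalAt (derivative (PL n)) z = p' at *
    generalize secondKindL γ W (PL (n + 1)) z = q1 at *
    generalize secondKindL γ W (PL n) z = q at *
    generalize pairing γ W (fun t => ((t - z) ^ 2)⁻¹) (PL (n + 1)) 1 = q1' at *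
    generalize pairing γ W (fun t => ((t - z) ^ 2)⁻¹) (PL n) 1 = q' at *
    generalize (PL (n + 1)).nextCoeff = a at *
    generalize (PR (n + 1)).nextCoeff = b at *
    congr 1
    · simp only [mul_zero, add_zero]
      rw [h1]
      simp only [add_mul, sub_mul, smul_mul_assoc, mul_smul_comm, mul_neg, mul_assoc]
      module
    · simp only [mul_zero, zero_add, mul_neg]
      rw [← sub_eq_add_neg, h2]
      simp only [add_mul, sub_mul, smul_mul_assoc, mul_assoc]
      module
    · have h5 : z ^ 2 • -(Cn n * p')
          + (-(Cn n * p) * (z • AL + BL) + -(Cn n * q) * 0)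
          = -(Cn n * (z ^ 2 • p' + p * (z • AL + BL))) := by
        simp only [mul_zero, add_zero, mul_add, mul_smul_comm, smul_neg, neg_mul, mul_assoc]
        module
      rw [h5, h3, prevC]
      push_cast
      simp only [mul_add, mul_sub, add_mul, sub_mul, smul_mul_assoc, mul_smul_comm, mul_neg,
        neg_mul, mul_assoc, mul_one, one_mul, hcc]
      module
    · have h5 : z ^ 2 • -(Cn n * q')
          + (-(Cn n * p) * 0 + -(Cn n * q) * -(z • AR + BR))
          = -(Cn n * (z ^ 2 • q' - q * (z • AR + BR))) := by
        simp only [mul_zero, zero_add, mul_add, mul_sub, mul_smul_comm, smul_neg, neg_mul, mul_neg,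
          mul_assoc, neg_add]
        module
      rw [h5, h4, prevC]
      push_cast
      simp only [mul_add, mul_sub, add_mul, sub_mul, smul_mul_assoc, mul_smul_comm, mul_neg,
        neg_mul, mul_assoc, mul_one, one_mul, hcc]
      module

/-! ### The fundamental matrices `Z` -/

/-- The diagonal factors of the two fundamental matrices are inverse after conjugation by the
symplectic unit, just as the `Y` factors are. -/
theorem ZL_mul_conj_ZR (hγ : IsLoop γ) (hW : LoopIntegrable γ W)
    {hL hR : ℂ → Mat N} (hWL : SolvesLeft hL WL) (hWR : SolvesRight hR WR)
    (hP : IsBiorthogonalSystem γ W PL PR Cn) {z : ℂ} (hz : z ∉ loopTrace γ)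
    (lg : ℂ → ℂ) (n : ℕ) :
    ZL γ W WL WR PL Cn lg n z * (sympl N * ZR γ W WL WR PR Cn lg n z * symplInv N) = 1 := by
  have hD : Matrix.fromBlocks (WL (lg z)) 0 0 (WR (lg z))⁻¹
      * (sympl N * Matrix.fromBlocks (WR (lg z)) 0 0 (WL (lg z))⁻¹ * symplInv N) = 1 := by
    rw [sympl_conj, Matrix.fromBlocks_multiply, ← Matrix.fromBlocks_one]
    simp [Matrix.mul_nonsing_inv _ (hWL.nonsingular (lg z)),
      Matrix.nonsing_inv_mul _ (hWR.nonsingular (lg z))]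
  calc ZL γ W WL WR PL Cn lg n z * (sympl N * ZR γ W WL WR PR Cn lg n z * symplInv N)
      = YL γ W PL Cn n z * (Matrix.fromBlocks (WL (lg z)) 0 0 (WR (lg z))⁻¹
        * (sympl N * Matrix.fromBlocks (WR (lg z)) 0 0 (WL (lg z))⁻¹ * symplInv N))
        * (sympl N * YR γ W PR Cn n z * symplInv N) := by
        simp only [ZL, ZR, mul_assoc]
        rw [← mul_assoc (symplInv N) (sympl N), symplInv_mul_sympl, one_mul]
    _ = 1 := by rw [hD, mul_one, YL_mul_conj_YR hγ hW hP hz]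

theorem analyticAt_ZL (hγ : IsLoop γ) (hW : LoopIntegrable γ W)
    {hL hR : ℂ → Mat N} (hWL : SolvesLeft hL WL) (hWR : SolvesRight hR WR)
    {z : ℂ} (hz : z ∉ loopTrace γ) {lg : ℂ → ℂ} (h : IsLogBranchAt lg z) (n : ℕ)
    (i j : Fin N ⊕ Fin N) : AnalyticAt ℂ (fun x => ZL γ W WL WR PL Cn lg n x i j) z :=
  analyticAt_mul_apply (analyticAt_YL hγ hW hz n)
    (analyticAt_fromBlocks (B := fun _ => 0) (C := fun _ => 0)
      (analyticAt_comp_branch h hWL.holomorphic) (fun _ _ => analyticAt_const)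
      (fun _ _ => analyticAt_const)
      (analyticAt_inv_apply (analyticAt_comp_branch h hWR.holomorphic) (hWR.nonsingular _))) i j

theorem analyticAt_ZR (hγ : IsLoop γ) (hW : LoopIntegrable γ W)
    {hL hR : ℂ → Mat N} (hWL : SolvesLeft hL WL) (hWR : SolvesRight hR WR)
    {z : ℂ} (hz : z ∉ loopTrace γ) {lg : ℂ → ℂ} (h : IsLogBranchAt lg z) (n : ℕ)
    (i j : Fin N ⊕ Fin N) : AnalyticAt ℂ (fun x => ZR γ W WL WR PR Cn lg n x i j) z :=
  analyticAt_mul_apply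
    (analyticAt_fromBlocks (B := fun _ => 0) (C := fun _ => 0)
      (analyticAt_comp_branch h hWR.holomorphic) (fun _ _ => analyticAt_const)
      (fun _ _ => analyticAt_const)
      (analyticAt_inv_apply (analyticAt_comp_branch h hWL.holomorphic) (hWL.nonsingular _)))
    (analyticAt_YR hγ hW hz n) i j

/-- Differentiating the diagonal factor multiplies it on the left by `diag(h^L, -h^R)`, which does
not depend on the branch. -/
theorem matDeriv_ZL (hγ : IsLoop γ) (hW : LoopIntegrable γ W)
    {hL hR : ℂ → Mat N} (hWL : SolvesLeft hL WL) (hWR : SolvesRight hR WR)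
    {z : ℂ} (hz : z ∉ loopTrace γ) {lg : ℂ → ℂ} (h : IsLogBranchAt lg z) (n : ℕ) :
    z ^ 2 • matDeriv (ZL γ W WL WR PL Cn lg n) z
      = (z ^ 2 • matDeriv (YL γ W PL Cn n) z
        + YL γ W PL Cn n z * Matrix.fromBlocks (hL z) 0 0 (-(hR z)))
        * Matrix.fromBlocks (WL (lg z)) 0 0 (WR (lg z))⁻¹ := by
  have hz0 := ne_zero_of_notMem_loopTrace hγ hz
  have h1 := matDeriv_mul (analyticAt_YL (PL := PL) (Cn := Cn) hγ hW hz n)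
    (analyticAt_fromBlocks (A := fun x => WL (lg x)) (B := fun _ => 0) (C := fun _ => 0)
      (D := fun x => (WR (lg x))⁻¹)
      (analyticAt_comp_branch h hWL.holomorphic) (fun _ _ => analyticAt_const)
      (fun _ _ => analyticAt_const)
      (analyticAt_inv_apply (analyticAt_comp_branch h hWR.holomorphic) (hWR.nonsingular _)))
  rw [matDeriv_fromBlocks, matDeriv_const] at h1
  change z ^ 2 • matDeriv (fun x => YL γ W PL Cn n x *
    Matrix.fromBlocks (WL (lg x)) 0 0 (WR (lg x))⁻¹) z = _
  rw [h1, smul_add, ← smul_mul_assoc (z ^ 2) (matDeriv _ z),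
    ← mul_smul_comm (z ^ 2) (YL γ W PL Cn n z), Matrix.fromBlocks_smul,
    matDeriv_left_branch h hz0 hWL, matDeriv_right_branch_inv h hz0 hWR, add_mul, mul_assoc _
    (Matrix.fromBlocks (hL z) 0 0 (-(hR z))), Matrix.fromBlocks_multiply (hL z)]
  simp

end blocks

end BesselMOP

end

/-! ### The structure matrices of the fundamental matrices -/

theorem mainTheorem4 {N : ℕ}
    (γ lgγ : ℝ → ℂ) (hγ : IsLoop γ) (hlg : IsLogAlong γ lgγ)
    (W : ℂ → Mat N) (hW : IsRegularBesselWeight γ lgγ W)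
    (AL BL AR BR : Mat N) (WL WR : ℂ → Mat N)
    (hWL : SolvesLeft (fun z => z • AL + BL) WL)
    (hWR : SolvesRight (fun z => z • AR + BR) WR)
    (hfac : Factorises γ lgγ W WL WR)
    (PL PR : ℕ → Polynomial (Mat N)) (C : ℕ → Mat N)
    (hP : IsBiorthogonalSystem γ W PL PR C)
    (n : ℕ) (z : ℂ) (hz : z ∉ loopTrace γ)
    (lg : ℂ → ℂ) (hlgz : IsLogBranchAt lg z) :
    (IsRegularAt (ZL γ W WL WR PL C lg n) z ∧
      z ^ 2 • leftLogDeriv (ZL γ W WL WR PL C lg n) z =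
        Matrix.fromBlocks
          (z • (AL + (n : ℂ) • (1 : Mat N))
            + matComm (PL n).nextCoeff AL - (PL n).nextCoeff + BL)
          (AL * (C n)⁻¹ + (C n)⁻¹ * AR + (2 * (n : ℂ) + 1) • (C n)⁻¹)
          (-(prevC C n * AL) - AR * prevC C n - (2 * (n : ℂ) - 1) • prevC C n)
          (-(z • ((n : ℂ) • (1 : Mat N) + AR))
            + matComm (PR n).nextCoeff AR + (PR n).nextCoeff - BR)) ∧
    (IsRegularAt (ZR γ W WL WR PR C lg n) z ∧
      z ^ 2 • rightLogDeriv (ZR γ W WL WR PR C lg n) z =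
        Matrix.fromBlocks
          (z • ((n : ℂ) • (1 : Mat N) + AR)
            - matComm (PR n).nextCoeff AR - (PR n).nextCoeff + BR)
          (-(prevC C n * AL) - AR * prevC C n - (2 * (n : ℂ) - 1) • prevC C n)
          (AL * (C n)⁻¹ + (C n)⁻¹ * AR + (2 * (n : ℂ) + 1) • (C n)⁻¹)
          (-(z • (AL + (n : ℂ) • (1 : Mat N)))
            - matComm (PL n).nextCoeff AL + (PL n).nextCoeff - BL)) := by
  have hWi : LoopIntegrable γ W := hW.integrable
  have hZ := ZL_mul_conj_ZR hγ hWi hWL hWR hP hz lg n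
  have hLa := analyticAt_ZL (PL := PL) (Cn := C) hγ hWi hWL hWR hz hlgz n
  have hRa := analyticAt_ZR (PR := PR) (Cn := C) hγ hWi hWL hWR hz hlgz n
  have hLu : IsUnit (ZL γ W WL WR PL C lg n z).det := Matrix.isUnit_det_of_right_inverse hZ
  have hLinv : (ZL γ W WL WR PL C lg n z)⁻¹
      = sympl N * ZR γ W WL WR PR C lg n z * symplInv N := Matrix.inv_eq_right_inv hZ
  have hR1 : (symplInv N * ZL γ W WL WR PL C lg n z * sympl N)
      * ZR γ W WL WR PR C lg n z = 1 := by
    have h := congrArg (fun M => symplInv N * M * sympl N) hZ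
    simp only [mul_assoc, symplInv_mul_sympl, mul_one] at h ⊢
    exact h
  have hRu : IsUnit (ZR γ W WL WR PR C lg n z).det := Matrix.isUnit_det_of_left_inverse hR1
  have hRinv := Matrix.inv_eq_left_inv hR1
  -- Any `M` solving the equation for `Y^L` is the scaled logarithmic derivative of `Z^L`: the
  -- diagonal factor is carried along and `Z^L` cancels on the right.
  have hM : ∀ M, z ^ 2 • matDeriv (YL γ W PL C n) z + YL γ W PL C n z
      * Matrix.fromBlocks (z • AL + BL) 0 0 (-(z • AR + BR)) = M * YL γ W PL C n z →
      z ^ 2 • leftLogDeriv (ZL γ W WL WR PL C lg n) z = M := by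
    intro M h
    rw [leftLogDeriv, ← smul_mul_assoc, matDeriv_ZL hγ hWi hWL hWR hz hlgz n, h,
      mul_assoc M (YL γ W PL C n z)]
    exact Matrix.mul_nonsing_inv_cancel_right _ _ hLu
  have hleft := hM _ (YL_relation hγ hlg hWi hWL hWR hfac hP hz n)
  refine ⟨⟨⟨hLa, hLu⟩, hleft⟩, ⟨hRa, hRu⟩, ?_⟩
  have hc : ∀ (M : BlockMat N) i j, AnalyticAt ℂ (fun _ : ℂ => M i j) z :=
    fun _ _ _ => analyticAt_const
  have hSa := analyticAt_mul_apply (hc (sympl N)) hRa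
  have hVa := analyticAt_mul_apply hSa (hc (symplInv N))
  -- The inverse relation holds on the open complement of the loop, hence near `z`, and may be
  -- differentiated.
  have hd := matDeriv_of_mul_eq_one hLa hVa
    (Filter.mem_of_superset (compl_loopTrace_mem_nhds hγ hz)
      fun x hx => ZL_mul_conj_ZR hγ hWi hWL hWR hP hx lg n)
  have hd' : matDeriv (fun x => sympl N * ZR γ W WL WR PR C lg n x * symplInv N) z
      = sympl N * matDeriv (ZR γ W WL WR PR C lg n) z * symplInv N := by
    rw [matDeriv_mul hSa (hc (symplInv N)), matDeriv_mul (hc (sympl N)) hRa, matDeriv_const,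
      matDeriv_const]
    simp
  have hright : rightLogDeriv (ZR γ W WL WR PR C lg n) z
      = -(symplInv N * leftLogDeriv (ZL γ W WL WR PL C lg n) z * sympl N) := by
    have h1 : matDeriv (ZR γ W WL WR PR C lg n) z
        = symplInv N * (sympl N * matDeriv (ZR γ W WL WR PR C lg n) z * symplInv N)
          * sympl N := by
      simp only [← mul_assoc, symplInv_mul_sympl, one_mul]
      rw [mul_assoc, symplInv_mul_sympl, mul_one]
    rw [rightLogDeriv, hRinv, h1, ← hd', hd, ← hLinv, leftLogDeriv]
    simp only [mul_neg, neg_mul, mul_assoc]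
    rw [← mul_assoc (sympl N) (symplInv N), sympl_mul_symplInv, one_mul,
      Matrix.mul_nonsing_inv_cancel_left _ _ hLu]
  -- Conjugation swaps the diagonal blocks, and swaps and negates the off-diagonal ones. With the
  -- overall minus sign, only the diagonal blocks change sign.
  rw [hright, smul_neg, ← smul_mul_assoc, ← mul_smul_comm, hleft, symplInv_conj,
    Matrix.fromBlocks_neg]
  congr 1
  · abel
  · rw [neg_neg]
  · rw [neg_neg]
  · abel
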